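/- **Setting.** Let $d\ge 2$, let $M$ and $\bar M$ be smooth Riemannian manifolds of dimension $d$, and let $\Omega\subseteq M$, $\bar\Omega\subseteq\bar M$ be open sets with compact closures $\Omega^{\mathrm{cl}}$, $\bar\Omega^{\mathrm{cl}}$. Let $\mu = I\,\mathrm{dVol}_M$ on $\Omega$, where $\mathrm{dVol}_M$ is the Riemannian volume, $I\ge 0$ on $\Omega$, $I\in C^\infty(\Omega^{\mathrm{cl}})$ and $\int_\Omega I\,\mathrm{dVol}_M=1$. Let $c$ be a real cost function that satisfies the following conditions. * (Reg) $c\in C^4(\Omega^{\mathrm{cl}}\times\bar\Omega^{\mathrm{cl}})$. (Here and for $I$, being $C^n$ on a closed set means being $C^n$ on an open neighbourhood of it.) * (Twist) For all $x_0\in\Omega^{\mathrm{cl}}$ and $\bar x_0\in\bar\Omega^{\mathrm{cl}}$, the maps $\bar x\mapsto -Dc(x_0,\bar x)$ on $\bar\Omega^{\mathrm{cl}}$ and $x\mapsto-\bar Dc(x,\bar x_0)$ on $\Omega^{\mathrm{cl}}$ are injective, where $D$, $\bar D$ are the differentials in the first and second variable. * (Nondeg) For all $(x,\bar x)\in \Omega^{\mathrm{cl}}\times\bar\Omega^{\mathrm{cl}}$,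 the linear map $-D\bar Dc(x,\bar x):T_xM\to T^*_{\bar x}\bar M$ is invertible. * (MTW$_+$) There is $\delta_0>0$ such that for all $(x,\bar x)\in \Omega^{\mathrm{cl}}\times\bar\Omega^{\mathrm{cl}}$, $V\in T_xM$ and $\eta\in T_x^*M$ with $\eta(V)=0$, $$-\left(c_{ij,\bar p\bar q}-c_{ij,\bar r}\,c^{\bar r,s}\,c_{s,\bar p\bar q}\right)c^{\bar p,k}c^{\bar q,l}(x,\bar x)\,V^iV^j\eta_k\eta_l\ \ge\ \delta_0|V|^2|\eta|^2 ,$$ in local coordinates, with summation over repeated indices, where unbarred (barred) lower indices are derivatives in the first (second) variable, $c^{\bar p,k}$ is the inverse matrix of $c_{k,\bar p}$, and $|V|$, $|\eta|$ are the norms of the Riemannian metric of $M$. Let $\bar x_1,\dots,\bar x_K\in\bar\Omega$ be distinct points. Assume that $-\bar Dc(\Omega,\bar x_l)\subseteq T^*_{\bar x_l}\bar M$ is convex for each $l$, and that $-Dc(x,\bar\Omega)\subseteq T^*_xM$ is convex for each $x\in\Omega$ (that is, $\Omega$ is $c$-convex with respect to each $\bar x_l$, and $\bar\Omega$ is $c$-convex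 with respect to $\Omega$). Fix $\mathbf d=(d_1,\dots,d_K)$ with all $d_l>0$ and an index $i$. For $\Delta\mathbf d=(\Delta d_1,\dots,\Delta d_K)\in\mathbb R^K$ with $\Delta d_i=0$ and $d_l+\Delta d_l>0$ for all $l$, put $|\Delta\mathbf d|=\max_l|\Delta d_l|$ and $$W_j=\{x\in\Omega: -c(x,\bar x_j)-\log d_j\le -c(x,\bar x_i)-\log d_i\},$$ $$W_j^{\Delta\mathbf d}=\{x\in\Omega: -c(x,\bar x_j)-\log (d_j+\Delta d_j)\le -c(x,\bar x_i)-\log d_i\}.$$ **Lemma.** For any $1\le j\ne k\le K$, $$\mu\left((W_j^{\Delta\mathbf d}\setminus W_j)\cap(W_k^{\Delta\mathbf d}\setminus W_k)\right)=o(|\Delta\mathbf d|),\qquad \mu\left((W_j\setminus W_j^{\Delta\mathbf d})\cap(W_k\setminus W_k^{\Delta\mathbf d})\right)=o(|\Delta\mathbf d|)$$ as $|\Delta\mathbf d|\to0$ (the rate may depend on $\mathbf d$). -/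

import Mathlib

open Set Filter Topology MeasureTheory Asymptotics Bundle
open scoped Manifold ContDiff

noncomputable section

/-! ### Riemannian volume -/

section Volume

variable {d : ℕ} {M : Type*} [TopologicalSpace M] [ChartedSpace (EuclideanSpace ℝ (Fin d)) M]
  [RiemannianBundle (fun x : M => TangentSpace (𝓡 d) x)]

/-- The matrix `g_{ab}` of the Riemannian metric in the preferred chart at `x₀`, at the point of `M`
with coordinates `u`; the `a`-th coordinate vector field is the image of the `a`-th basis vector
under the differential of the inverse chart. -/
def metricMatrix (x₀ : M) (u : EuclideanSpace ℝ (Fin d)) : Matrix (Fin d) (Fin d) ℝ :=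
  Matrix.of fun a b =>
    inner ℝ
      (mfderiv (𝓡 d) (𝓡 d) (extChartAt (𝓡 d) x₀).symm u (EuclideanSpace.single a (1 : ℝ)) :
        TangentSpace (𝓡 d) ((extChartAt (𝓡 d) x₀).symm u))
      (mfderiv (𝓡 d) (𝓡 d) (extChartAt (𝓡 d) x₀).symm u (EuclideanSpace.single b (1 : ℝ)) :
        TangentSpace (𝓡 d) ((extChartAt (𝓡 d) x₀).symm u))

/-- The Riemannian volume of the domain of the preferred chart at `x₀` (extended by zero to `M`):
the image under the inverse chart of `√(det g) du`. -/
def chartVolume [MeasurableSpace M] (x₀ : M) : Measure M :=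
  Measure.map (extChartAt (𝓡 d) x₀).symm
    ((volume.restrict (extChartAt (𝓡 d) x₀).target).withDensity
      fun u => ENNReal.ofReal (Real.sqrt (metricMatrix x₀ u).det))

variable (d M) in
/-- The Riemannian volume measure of `M`. The measures `chartVolume x₀` agree on the overlaps of
their chart domains, so on a second countable manifold their supremum is the only measure that
restricts to `chartVolume x₀` on the domain of the chart at `x₀`, for all `x₀`. -/
def riemannianVolume [MeasurableSpace M] : Measure M :=
  ⨆ x₀ : M, chartVolume (d := d) x₀

end Volume

/-! ### Cost functions -/

section Cost

variable {d : ℕ}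
  {M : Type*} [TopologicalSpace M] [ChartedSpace (EuclideanSpace ℝ (Fin d)) M]
  {N : Type*} [TopologicalSpace N] [ChartedSpace (EuclideanSpace ℝ (Fin d)) N]

/-- `f` is of class `C^n` on the set `s`, up to the boundary: it is `C^n` on an open neighbourhood
of `s`. -/
def IsSmoothUpToBoundary {H : Type*} [TopologicalSpace H] {E : Type*} [NormedAddCommGroup E]
    [NormedSpace ℝ E] (J : ModelWithCorners ℝ E H) {P : Type*} [TopologicalSpace P]
    [ChartedSpace H P] (n : WithTop ℕ∞) (f : P → ℝ) (s : Set P) : Prop :=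
  ∃ U : Set P, IsOpen U ∧ s ⊆ U ∧ ContMDiffOn J 𝓘(ℝ, ℝ) n f U

/-- `Dc(x, y) ∈ T*_x M`, the differential of the cost in the first variable. -/
def costDFst (c : M → N → ℝ) (x : M) (y : N) : TangentSpace (𝓡 d) x →L[ℝ] ℝ :=
  mfderiv (𝓡 d) 𝓘(ℝ, ℝ) (fun x' => c x' y) x

/-- `D̄c(x, y) ∈ T*_y N`, the differential of the cost in the second variable. -/
def costDSnd (c : M → N → ℝ) (x : M) (y : N) : TangentSpace (𝓡 d) y →L[ℝ] ℝ :=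
  mfderiv (𝓡 d) 𝓘(ℝ, ℝ) (fun y' => c x y') y

/-- The twist condition on `A × B`. -/
def TwistOn (d : ℕ) {M : Type*} [TopologicalSpace M] [ChartedSpace (EuclideanSpace ℝ (Fin d)) M]
    {N : Type*} [TopologicalSpace N] [ChartedSpace (EuclideanSpace ℝ (Fin d)) N]
    (c : M → N → ℝ) (A : Set M) (B : Set N) : Prop :=
  (∀ x ∈ A, InjOn (fun y => -costDFst (d := d) c x y) B) ∧
    ∀ y ∈ B, InjOn (fun x => -costDSnd (d := d) c x y) A

/-- The cost in the preferred charts at `x₀` and `y₀`. -/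
def costInCharts (c : M → N → ℝ) (x₀ : M) (y₀ : N) :
    EuclideanSpace ℝ (Fin d) → EuclideanSpace ℝ (Fin d) → ℝ :=
  fun u w => c ((extChartAt (𝓡 d) x₀).symm u) ((extChartAt (𝓡 d) y₀).symm w)

/-- Partial derivative in the `i`-th coordinate of the first variable. -/
def pdFst (i : Fin d) (F : EuclideanSpace ℝ (Fin d) → EuclideanSpace ℝ (Fin d) → ℝ) :
    EuclideanSpace ℝ (Fin d) → EuclideanSpace ℝ (Fin d) → ℝ :=
  fun u w => fderiv ℝ (fun u' => F u' w) u (EuclideanSpace.single i (1 : ℝ))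

/-- Partial derivative in the `p`-th coordinate of the second variable. -/
def pdSnd (p : Fin d) (F : EuclideanSpace ℝ (Fin d) → EuclideanSpace ℝ (Fin d) → ℝ) :
    EuclideanSpace ℝ (Fin d) → EuclideanSpace ℝ (Fin d) → ℝ :=
  fun u w => fderiv ℝ (fun w' => F u w') w (EuclideanSpace.single p (1 : ℝ))

variable (d) in
/-- The matrix `c_{i, p̄}(x, y)` of mixed second derivatives, in the preferred charts at `x` and `y`:
row `i` is a coordinate on `M`, column `p` a coordinate on `N`. -/
def mixedHessian (c : M → N → ℝ) (x : M) (y : N) : Matrix (Fin d) (Fin d) ℝ :=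
  Matrix.of fun i p =>
    pdFst i (pdSnd p (costInCharts c x y)) (extChartAt (𝓡 d) x x) (extChartAt (𝓡 d) y y)

/-- The nondegeneracy condition on `A × B`: the linear maps `-D D̄ c(x, y) : T_x M → T*_y N` are
invertible. -/
def NondegOn (d : ℕ) {M : Type*} [TopologicalSpace M] [ChartedSpace (EuclideanSpace ℝ (Fin d)) M]
    {N : Type*} [TopologicalSpace N] [ChartedSpace (EuclideanSpace ℝ (Fin d)) N]
    (c : M → N → ℝ) (A : Set M) (B : Set N) : Prop :=
  ∀ x ∈ A, ∀ y ∈ B, IsUnit (-mixedHessian d c x y)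

/-- The component `MTW_{ij}^{kl}(x, y)` of the Ma–Trudinger–Wang tensor,
`-(c_{ij, p̄q̄} - c_{ij, r̄} c^{r̄, s} c_{s, p̄q̄}) c^{p̄, k} c^{q̄, l}`
(sum over `p, q, r, s`), in the preferred charts at `x` and `y`. -/
def mtwCoord (c : M → N → ℝ) (x : M) (y : N) (i j k l : Fin d) : ℝ :=
  let C := costInCharts (d := d) c x y
  let u := extChartAt (𝓡 d) x x
  let w := extChartAt (𝓡 d) y y
  let cinv : Matrix (Fin d) (Fin d) ℝ := (mixedHessian d c x y)⁻¹
  ∑ p, ∑ q,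
    -(pdFst i (pdFst j (pdSnd p (pdSnd q C))) u w -
        ∑ r, ∑ s, pdFst i (pdFst j (pdSnd r C)) u w * cinv r s *
          pdFst s (pdSnd p (pdSnd q C)) u w) *
      cinv p k * cinv q l

/-- The components of a tangent vector in the preferred chart at its base point `x`; Mathlib
identifies `T_x M` with the model space through the differential of that chart at `x`. -/
def tangentCoord {x : M} (V : TangentSpace (𝓡 d) x) (i : Fin d) : ℝ :=
  let v : EuclideanSpace ℝ (Fin d) := V
  v i

/-- The `k`-th coordinate tangent vector at `x` in the preferred chart at `x`. -/
def tangentBasis (x : M) (k : Fin d) : TangentSpace (𝓡 d) x :=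
  (EuclideanSpace.single k (1 : ℝ) : EuclideanSpace ℝ (Fin d))

/-- The strong Ma–Trudinger–Wang condition on `A × B`. The norms of `V` and `η` are those given by
the Riemannian metric of `M`. -/
def StrongMTWOn (d : ℕ) {M : Type*} [TopologicalSpace M]
    [ChartedSpace (EuclideanSpace ℝ (Fin d)) M]
    [RiemannianBundle (fun x : M => TangentSpace (𝓡 d) x)]
    {N : Type*} [TopologicalSpace N] [ChartedSpace (EuclideanSpace ℝ (Fin d)) N]
    (c : M → N → ℝ) (A : Set M) (B : Set N) : Prop :=
  ∃ δ₀ : ℝ, 0 < δ₀ ∧ ∀ x ∈ A, ∀ y ∈ B,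
    ∀ (V : TangentSpace (𝓡 d) x) (η : TangentSpace (𝓡 d) x →L[ℝ] ℝ), η V = 0 →
      δ₀ * ‖V‖ ^ 2 * ‖η‖ ^ 2 ≤
        ∑ i, ∑ j, ∑ k, ∑ l, mtwCoord c x y i j k l *
          tangentCoord V i * tangentCoord V j * η (tangentBasis x k) * η (tangentBasis x l)

/-- `A ⊆ M` is `c`-convex with respect to `y ∈ N`: the set `-D̄c(A, y)` is convex in `T*_y N`. -/
def CConvexFst (d : ℕ) {M : Type*} [TopologicalSpace M]
    [ChartedSpace (EuclideanSpace ℝ (Fin d)) M]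
    {N : Type*} [TopologicalSpace N] [ChartedSpace (EuclideanSpace ℝ (Fin d)) N]
    (c : M → N → ℝ) (A : Set M) (y : N) : Prop :=
  Convex ℝ ((fun x => -costDSnd (d := d) c x y) '' A)

/-- `B ⊆ N` is `c`-convex with respect to `x ∈ M`: the set `-Dc(x, B)` is convex in `T*_x M`. -/
def CConvexSnd (d : ℕ) {M : Type*} [TopologicalSpace M]
    [ChartedSpace (EuclideanSpace ℝ (Fin d)) M]
    {N : Type*} [TopologicalSpace N] [ChartedSpace (EuclideanSpace ℝ (Fin d)) N]
    (c : M → N → ℝ) (B : Set N) (x : M) : Prop :=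
  Convex ℝ ((fun y => -costDFst (d := d) c x y) '' B)

end Cost

/-! ### The sets `W_j` and `W_j^{Δd}` -/

section Sets

variable {M N : Type*} {K : ℕ}

/-- `W_j`, for a fixed index `i` and weights `w` (written `d` in the literature). -/
def wSet (c : M → N → ℝ) (Ω : Set M) (y : Fin K → N) (w : Fin K → ℝ) (i j : Fin K) : Set M :=
  {x ∈ Ω | -c x (y j) - Real.log (w j) ≤ -c x (y i) - Real.log (w i)}

/-- `W_j^{Δd}`, for a fixed index `i`, weights `w` and increment `Δ` of the weights. -/
def wSetDelta (c : M → N → ℝ) (Ω : Set M) (y : Fin K → N) (w Δ : Fin K → ℝ) (i j : Fin K) :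
    Set M :=
  {x ∈ Ω | -c x (y j) - Real.log (w j + Δ j) ≤ -c x (y i) - Real.log (w i)}

end Sets

end

/-!
The set `W_j^{Δd} \ W_j` is a layer of width `O(|Δd|)` at the level set of
`g_j = c(·, y_i) - c(·, y_j)` at height `log d_j - log d_i`, so both intersections lie in a set
`{|g_j - b_j| ≤ t, |g_k - b_k| ≤ t}` with `t = O(|Δd|)`, and it is enough that the volume of this
set is `o(t)`. By compactness of `closure Ω` this is a local question at each `z ∈ closure Ω`, and
the Riemannian volume can be replaced by the Lebesgue measure of a chart
(`exists_riemannianVolume_le`). By the twist condition `Dg_j ≠ 0`. There are two cases.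

* If `Dg_j` and `Dg_k` are linearly independent at `z`, then `(g_j, g_k)` are part of a coordinate
  system near `z` and the volume is `O(t²)` (`exists_nhds_measure_abs_le_abs_le`).
* If `Dg_k = a Dg_j` at `z`, then with `h = g_k - a g_j` it is enough to find a vector `V` in the
  kernel of `Dg_j` with `D²h(V, V) ≠ 0`. The Jacobian determinant `q` of `(g_j, h)` in the
  direction `V` and a transversal direction then vanishes at `z`, while `(g_j, q)` has rank two
  there. So the part of the set where `|q| ≤ ε` has volume `O(ε t)`, uniformly in `ε`, and the part
  where `|q| ≥ ε` has volume `O(t²)` with a constant depending on `ε`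
  (`exists_nhds_measure_abs_le_abs_le_isLittleO`).

In the second case every nonzero `V` in the kernel of `Dg_j` works, and there is one because
`d ≥ 2`. The covectors `-Dc(z, y_i)`, `-Dc(z, y_j)`, `-Dc(z, y_k)` are distinct points of a line.
The segment they span is, by `c`-convexity of `Ω'` and a limit argument if `z` is a boundary point
of `Ω` (`exists_costGrad_eq_of_mem_closure`), the image under `-Dc(z, ·)` of a curve `y(s)` in
`closure Ω'`, a `c`-segment. The second derivative of `s ↦ -D²_x c(z, y(s))(V, V)` is the
Ma–Trudinger–Wang tensor (`deriv_deriv_along_cSegment`), which is positive as `V` is annihilated by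
the direction of the segment. A strictly convex function is not affine on three points
(`costSecond_sub_ne_mul_sub`), which is what `D²h(V, V) = 0` would say.
-/

/-! ### Volume of slabs between level sets of two independent functions -/

section SlabVolume

open scoped NNReal ENNReal

variable {E : Type*} [NormedAddCommGroup E] [NormedSpace ℝ E]

/-- Coordinates adapted to two linear forms `A₁, A₂` with dual vectors `e₁, e₂`: a vector is
determined by its values under the forms and its component in the common kernel. -/
def slabEquiv (A₁ A₂ : E →L[ℝ] ℝ) (e₁ e₂ : E) (h11 : A₁ e₁ = 1) (h12 : A₁ e₂ = 0)
    (h21 : A₂ e₁ = 0) (h22 : A₂ e₂ = 1) :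
    E ≃ₗ[ℝ] (ℝ × ℝ) × (A₁.prod A₂).ker where
  toFun x := ((A₁ x, A₂ x), ⟨x - A₁ x • e₁ - A₂ x • e₂, by
    simp [LinearMap.mem_ker, h11, h12, h21, h22]⟩)
  invFun p := p.1.1 • e₁ + p.1.2 • e₂ + (p.2 : E)
  map_add' x y := by
    refine Prod.ext (Prod.ext (map_add A₁ x y) (map_add A₂ x y)) (Subtype.ext ?_)
    change x + y - A₁ (x + y) • e₁ - A₂ (x + y) • e₂ =
      (x - A₁ x • e₁ - A₂ x • e₂) + (y - A₁ y • e₁ - A₂ y • e₂)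
    rw [map_add, map_add]
    module
  map_smul' a x := by
    refine Prod.ext (Prod.ext (map_smul A₁ a x) (map_smul A₂ a x)) (Subtype.ext ?_)
    change a • x - A₁ (a • x) • e₁ - A₂ (a • x) • e₂ = a • (x - A₁ x • e₁ - A₂ x • e₂)
    rw [map_smul, map_smul, smul_eq_mul, smul_eq_mul]
    module
  left_inv x := by simp
  right_inv p := by
    obtain ⟨⟨a, b⟩, ⟨k, hk⟩⟩ := p
    simp only [LinearMap.mem_ker, ContinuousLinearMap.coe_coe, ContinuousLinearMap.prod_apply,
      Prod.mk_eq_zero] at hk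
    refine Prod.ext (Prod.ext ?_ ?_) (Subtype.ext ?_) <;> simp [h11, h12, h21, h22, hk.1, hk.2]
    abel

variable [FiniteDimensional ℝ E] [MeasurableSpace E] [BorelSpace E]

/-- In the coordinates of `slabEquiv` the slab is contained in a product of two intervals and a
bounded set. -/
theorem addHaar_slab_le (μ : Measure E) [μ.IsAddHaarMeasure] (A₁ A₂ : E →L[ℝ] ℝ) (e₁ e₂ : E)
    (h11 : A₁ e₁ = 1) (h12 : A₁ e₂ = 0) (h21 : A₂ e₁ = 0) (h22 : A₂ e₂ = 1) (R : ℝ) :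
    ∃ C : ℝ≥0, ∀ s t : ℝ,
      μ {x | ‖x‖ ≤ R ∧ |A₁ x| ≤ s ∧ |A₂ x| ≤ t} ≤ C * (ENNReal.ofReal s * ENNReal.ofReal t) := by
  let L := (slabEquiv A₁ A₂ e₁ e₂ h11 h12 h21 h22).toContinuousLinearEquiv
  have hL : ∀ x, L x = slabEquiv A₁ A₂ e₁ e₂ h11 h12 h21 h22 x := fun _ => rfl
  let F : Type _ := (A₁.prod A₂).ker
  borelize F
  let ν : Measure F := Measure.addHaar
  have : (μ.map L).IsAddHaarMeasure := L.isAddHaarMeasure_map μ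
  have hμ : μ.map L = Measure.addHaarScalarFactor (μ.map L) ((volume : Measure (ℝ × ℝ)).prod ν) •
      ((volume : Measure (ℝ × ℝ)).prod ν) := Measure.isAddLeftInvariant_eq_smul _ _
  set c := Measure.addHaarScalarFactor (μ.map L) ((volume : Measure (ℝ × ℝ)).prod ν)
  let R' : ℝ := ‖(L : E →L[ℝ] (ℝ × ℝ) × F)‖ * R
  have hB : ν (Metric.closedBall 0 R') < ⊤ := measure_closedBall_lt_top
  refine ⟨c * (4 * (ν (Metric.closedBall 0 R')).toNNReal), fun s t => ?_⟩
  let box : Set ((ℝ × ℝ) × F) := (Icc (-s) s ×ˢ Icc (-t) t) ×ˢ Metric.closedBall 0 R'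
  have hsub : {x | ‖x‖ ≤ R ∧ |A₁ x| ≤ s ∧ |A₂ x| ≤ t} ⊆ L ⁻¹' box := by
    rintro x ⟨hx, h1, h2⟩
    refine ⟨⟨abs_le.1 h1, abs_le.1 h2⟩, ?_⟩
    rw [mem_closedBall_zero_iff]
    calc ‖(L x).2‖ ≤ ‖L x‖ := norm_snd_le _
      _ ≤ ‖(L : E →L[ℝ] (ℝ × ℝ) × F)‖ * ‖x‖ := (L : E →L[ℝ] (ℝ × ℝ) × F).le_opNorm x
      _ ≤ R' := mul_le_mul_of_nonneg_left hx (ContinuousLinearMap.opNorm_nonneg _)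
  have hbox : MeasurableSet box :=
    (measurableSet_Icc.prod measurableSet_Icc).prod measurableSet_closedBall
  calc μ _ ≤ μ (L ⁻¹' box) := measure_mono hsub
    _ = μ.map L box := (Measure.map_apply L.continuous.measurable hbox).symm
    _ = c * (volume (Icc (-s) s) * volume (Icc (-t) t) * ν (Metric.closedBall 0 R')) := by
        rw [hμ, Measure.smul_apply, Measure.prod_prod, Measure.volume_eq_prod, Measure.prod_prod]
        rfl
    _ = _ := by
        rw [Real.volume_Icc, Real.volume_Icc]
        have h2 : ∀ r : ℝ, ENNReal.ofReal (r - -r) = 2 * ENNReal.ofReal r := fun r => by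
          rw [sub_neg_eq_add, ← two_mul, ENNReal.ofReal_mul (by norm_num)]; simp
        rw [h2, h2]
        push_cast
        rw [ENNReal.coe_toNNReal hB.ne]
        have h4 : (4 : ℝ≥0∞) = 2 * 2 := by norm_num
        rw [h4]
        ring

/-- Near `z`, the map `Φ` below is close to a translation and satisfies `A₁ ∘ Φ = G₁` and
`A₂ ∘ Φ = G₂`, so that it reduces the estimate to linear slabs without distorting volumes much. -/
theorem exists_nhds_measure_abs_le_abs_le (μ : Measure E) [μ.IsAddHaarMeasure] {G₁ G₂ : E → ℝ}
    {A₁ A₂ : E →L[ℝ] ℝ} {z : E} (hG₁ : HasStrictFDerivAt G₁ A₁ z) (hG₂ : HasStrictFDerivAt G₂ A₂ z)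
    {e₁ e₂ : E} (h11 : A₁ e₁ = 1) (h12 : A₁ e₂ = 0) (h21 : A₂ e₁ = 0) (h22 : A₂ e₂ = 1) :
    ∃ U ∈ 𝓝 z, ∃ C : ℝ≥0, ∀ s t : ℝ,
      μ {x ∈ U | |G₁ x| ≤ s ∧ |G₂ x| ≤ t} ≤ C * (ENNReal.ofReal s * ENNReal.ofReal t) := by
  let Φ : E → E := fun x =>
    (x - z) + (G₁ x - A₁ (x - z)) • e₁ + (G₂ x - A₂ (x - z)) • e₂
  have hΦ1 : ∀ x, A₁ (Φ x) = G₁ x := fun x => by simp [Φ, h11, h12]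
  have hΦ2 : ∀ x, A₂ (Φ x) = G₂ x := fun x => by simp [Φ, h21, h22]
  have hΦ : HasStrictFDerivAt Φ (ContinuousLinearMap.id ℝ E) z := by
    have hid : HasStrictFDerivAt (fun x : E => x - z) (ContinuousLinearMap.id ℝ E) z :=
      (hasStrictFDerivAt_id z).sub_const z
    have h1 := (hG₁.sub (A₁.hasStrictFDerivAt.comp z hid)).smul_const e₁
    have h2 := (hG₂.sub (A₂.hasStrictFDerivAt.comp z hid)).smul_const e₂
    refine ((hid.add h1).add h2).congr_fderiv ?_
    ext v
    simp
  have hev := mul_le_addHaar_image_of_lt_det μ (ContinuousLinearMap.id ℝ E) (m := 1 / 2) (by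
    rw [ContinuousLinearMap.det, ContinuousLinearMap.coe_id, LinearMap.det_id]
    simp)
  obtain ⟨δ, hδ, hδ0⟩ := (hev.and self_mem_nhdsWithin).exists
  obtain ⟨U, hU, hUa⟩ := hΦ.approximates_deriv_on_nhds (Or.inr hδ0)
  have hcont : ∀ᶠ x in 𝓝 z, ‖Φ x‖ < ‖Φ z‖ + 1 :=
    (hΦ.continuousAt.norm).eventually_lt_const (by linarith)
  obtain ⟨C, hC⟩ := addHaar_slab_le μ A₁ A₂ e₁ e₂ h11 h12 h21 h22 (‖Φ z‖ + 1)
  refine ⟨U ∩ {x | ‖Φ x‖ < ‖Φ z‖ + 1}, inter_mem hU hcont, 2 * C, fun s t => ?_⟩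
  set S := {x ∈ U ∩ {x | ‖Φ x‖ < ‖Φ z‖ + 1} | |G₁ x| ≤ s ∧ |G₂ x| ≤ t}
  have h1 := hδ S Φ (hUa.mono_set fun x hx => hx.1.1)
  have h2 : μ (Φ '' S) ≤ C * (ENNReal.ofReal s * ENNReal.ofReal t) := by
    refine le_trans (measure_mono ?_) (hC s t)
    rintro _ ⟨x, ⟨⟨-, hx⟩, h1, h2⟩, rfl⟩
    exact ⟨le_of_lt hx, by rwa [hΦ1], by rwa [hΦ2]⟩
  calc μ S = 2 * (((1 / 2 : ℝ≥0) : ℝ≥0∞) * μ S) := by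
        rw [← mul_assoc]
        have : (2 : ℝ≥0∞) * ((1 / 2 : ℝ≥0) : ℝ≥0∞) = 1 := by
          rw [show (2 : ℝ≥0∞) = ((2 : ℝ≥0) : ℝ≥0∞) from rfl, ← ENNReal.coe_mul]
          norm_num
        rw [this, one_mul]
    _ ≤ 2 * (C * (ENNReal.ofReal s * ENNReal.ofReal t)) := mul_le_mul_right (h1.trans h2) 2
    _ = _ := by push_cast; ring

/-- The estimate of `exists_nhds_measure_abs_le_abs_le` near a point where the Jacobian determinant
of `(G₁, G₂)` in the directions `v₁, v₂` does not vanish. -/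
theorem exists_nhds_measure_abs_le_abs_le_of_det (μ : Measure E) [μ.IsAddHaarMeasure]
    {G₁ G₂ : E → ℝ} {A₁ A₂ : E →L[ℝ] ℝ} {z : E} (hG₁ : HasStrictFDerivAt G₁ A₁ z)
    (hG₂ : HasStrictFDerivAt G₂ A₂ z) {v₁ v₂ : E} (hdet : A₁ v₁ * A₂ v₂ - A₁ v₂ * A₂ v₁ ≠ 0) :
    ∃ U ∈ 𝓝 z, ∃ C : ℝ≥0, ∀ s t : ℝ,
      μ {x ∈ U | |G₁ x| ≤ s ∧ |G₂ x| ≤ t} ≤ C * (ENNReal.ofReal s * ENNReal.ofReal t) := by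
  set D := A₁ v₁ * A₂ v₂ - A₁ v₂ * A₂ v₁ with hD
  refine exists_nhds_measure_abs_le_abs_le μ hG₁ hG₂
    (e₁ := D⁻¹ • (A₂ v₂ • v₁ - A₂ v₁ • v₂)) (e₂ := D⁻¹ • (A₁ v₁ • v₂ - A₁ v₂ • v₁)) ?_ ?_ ?_ ?_
  all_goals simp only [map_smul, map_sub, smul_eq_mul]
  · field_simp
    rw [hD]
    ring
  · ring
  · ring
  · field_simp
    rw [hD]

end SlabVolume

/-! ### Volume of slabs where the gradients may become parallel -/

section SublevelVolume

open scoped NNReal ENNReal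

variable {E : Type*} [NormedAddCommGroup E] [NormedSpace ℝ E] [FiniteDimensional ℝ E]
  [MeasurableSpace E] [BorelSpace E]

theorem eventually_mul_ofReal_mul_ofReal_le (C : ℝ≥0) (B : ℝ) {ε : ℝ} (hε : 0 < ε) :
    ∀ᶠ t in 𝓝[≥] (0 : ℝ),
      C * (ENNReal.ofReal t * ENNReal.ofReal (B * t)) ≤ ENNReal.ofReal (ε * t) := by
  have h : ∀ᶠ t in 𝓝[≥] (0 : ℝ), C * B * t < ε := by
    have : Tendsto (fun t : ℝ => C * B * t) (𝓝 0) (𝓝 (C * B * 0)) := tendsto_id.const_mul _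
    rw [mul_zero] at this
    exact nhdsWithin_le_nhds (this.eventually_lt_const hε)
  filter_upwards [h, self_mem_nhdsWithin] with t ht ht0
  have ht0 : 0 ≤ t := ht0
  rw [← ENNReal.ofReal_coe_nnreal, ← ENNReal.ofReal_mul ht0, ← ENNReal.ofReal_mul C.coe_nonneg]
  refine ENNReal.ofReal_le_ofReal ?_
  nlinarith [mul_le_mul_of_nonneg_right ht.le ht0]

/-- On a compact set where the Jacobian determinant of `(g, h)` in two fixed directions does not
vanish, the set `|g| ≤ s`, `|h| ≤ t` has volume `O(s t)`. -/
theorem exists_measure_abs_le_abs_le_of_isCompact (μ : Measure E) [μ.IsAddHaarMeasure]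
    {g h : E → ℝ} {K : Set E} (hK : IsCompact K) (hg : ∀ x ∈ K, ContDiffAt ℝ 1 g x)
    (hh : ∀ x ∈ K, ContDiffAt ℝ 1 h x) {v₁ v₂ : E}
    (hdet : ∀ x ∈ K, fderiv ℝ g x v₁ * fderiv ℝ h x v₂ - fderiv ℝ g x v₂ * fderiv ℝ h x v₁ ≠ 0) :
    ∃ C : ℝ≥0, ∀ s t : ℝ,
      μ {x ∈ K | |g x| ≤ s ∧ |h x| ≤ t} ≤ C * (ENNReal.ofReal s * ENNReal.ofReal t) := by
  refine hK.induction_on (p := fun S => ∃ C : ℝ≥0, ∀ s t : ℝ,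
      μ {x ∈ S | |g x| ≤ s ∧ |h x| ≤ t} ≤ C * (ENNReal.ofReal s * ENNReal.ofReal t))
    ?_ ?_ ?_ ?_
  · exact ⟨0, by simp⟩
  · rintro S T hST ⟨C, hC⟩
    refine ⟨C, fun s t => le_trans (measure_mono ?_) (hC s t)⟩
    exact fun x hx => ⟨hST hx.1, hx.2⟩
  · rintro S T ⟨C, hC⟩ ⟨C', hC'⟩
    refine ⟨C + C', fun s t => ?_⟩
    calc μ {x ∈ S ∪ T | |g x| ≤ s ∧ |h x| ≤ t}
        ≤ μ ({x ∈ S | |g x| ≤ s ∧ |h x| ≤ t} ∪ {x ∈ T | |g x| ≤ s ∧ |h x| ≤ t}) :=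
          measure_mono fun x hx =>
            hx.1.elim (fun h1 => Or.inl ⟨h1, hx.2⟩) (fun h1 => Or.inr ⟨h1, hx.2⟩)
      _ ≤ _ := measure_union_le _ _
      _ ≤ _ := add_le_add (hC s t) (hC' s t)
      _ = _ := by push_cast; ring
  · intro x hx
    obtain ⟨U, hU, C, hC⟩ := exists_nhds_measure_abs_le_abs_le_of_det μ
      ((hg x hx).hasStrictFDerivAt one_ne_zero) ((hh x hx).hasStrictFDerivAt one_ne_zero)
      (hdet x hx)
    exact ⟨U, mem_nhdsWithin_of_mem_nhds hU, C, hC⟩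

/-- Where the differentials of `g₁` and `g₂` are proportional, the Jacobian determinant `q` of
`(g₁, g₂ - a g₁)` vanishes, but a second derivative keeps `(g₁, q)` of rank two. The part
`|q| ≤ ε` of the set then has volume `O(ε t)`, and the part `|q| ≥ ε` has volume
`O(t²)` with a constant that depends on `ε`. -/
theorem exists_nhds_measure_abs_le_abs_le_isLittleO (μ : Measure E) [μ.IsAddHaarMeasure]
    {g₁ g₂ : E → ℝ} {z : E} (h₁ : ContDiffAt ℝ 2 g₁ z) (h₂ : ContDiffAt ℝ 2 g₂ z)
    (hne : fderiv ℝ g₁ z ≠ 0)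
    (hcurv : ∀ a : ℝ, fderiv ℝ g₂ z = a • fderiv ℝ g₁ z → ∃ V : E, fderiv ℝ g₁ z V = 0 ∧
      fderiv ℝ (fun x => fderiv ℝ g₂ x V) z V ≠ a * fderiv ℝ (fun x => fderiv ℝ g₁ x V) z V) :
    ∃ U ∈ 𝓝 z, ∀ ε : ℝ, 0 < ε → ∀ᶠ t in 𝓝[≥] (0 : ℝ),
      μ {x ∈ U | |g₁ x| ≤ t ∧ |g₂ x| ≤ t} ≤ ENNReal.ofReal (ε * t) := by
  obtain ⟨e, he⟩ : ∃ e, fderiv ℝ g₁ z e ≠ 0 := by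
    by_contra! h
    exact hne (ContinuousLinearMap.ext h)
  set a : ℝ := fderiv ℝ g₂ z e / fderiv ℝ g₁ z e with ha
  by_cases hpar : fderiv ℝ g₂ z = a • fderiv ℝ g₁ z
  swap
  · -- The differentials are linearly independent.
    obtain ⟨v, hv⟩ : ∃ v, fderiv ℝ g₂ z v ≠ a * fderiv ℝ g₁ z v := by
      by_contra! h
      exact hpar (ContinuousLinearMap.ext fun v => by simpa using h v)
    obtain ⟨U, hU, C, hC⟩ := exists_nhds_measure_abs_le_abs_le_of_det μ
      (h₁.hasStrictFDerivAt two_ne_zero) (h₂.hasStrictFDerivAt two_ne_zero) (v₁ := e) (v₂ := v) (by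
        intro h0
        apply hv
        rw [ha]
        field_simp
        linarith)
    refine ⟨U, hU, fun ε hε => ?_⟩
    filter_upwards [eventually_mul_ofReal_mul_ofReal_le C 1 hε] with t ht
    rw [one_mul] at ht
    exact (hC t t).trans ht
  obtain ⟨V, hV0, hV⟩ := hcurv a hpar
  set h : E → ℝ := fun x => g₂ x - a * g₁ x with hh
  have hC₁ : ∀ᶠ x in 𝓝 z, ContDiffAt ℝ 2 g₁ x := h₁.eventually (by simp)
  have hC₂ : ∀ᶠ x in 𝓝 z, ContDiffAt ℝ 2 g₂ x := h₂.eventually (by simp)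
  have hhC : ∀ x, ContDiffAt ℝ 2 g₁ x → ContDiffAt ℝ 2 g₂ x → ContDiffAt ℝ 2 h x :=
    fun x h1 h2 => h2.sub (contDiffAt_const.mul h1)
  have hfd : ∀ {f : E → ℝ} {x : E} (v : E), ContDiffAt ℝ 2 f x →
      ContDiffAt ℝ 1 (fun y => fderiv ℝ f y v) x := fun v hf =>
    (hf.fderiv_right (m := 1) (by norm_num)).clm_apply contDiffAt_const
  set q : E → ℝ := fun x =>
    fderiv ℝ g₁ x e * fderiv ℝ h x V - fderiv ℝ g₁ x V * fderiv ℝ h x e with hq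
  have hqC : ∀ x, ContDiffAt ℝ 2 g₁ x → ContDiffAt ℝ 2 g₂ x → ContDiffAt ℝ 1 q x :=
    fun x h1 h2 => ((hfd e h1).mul (hfd V (hhC x h1 h2))).sub
      ((hfd V h1).mul (hfd e (hhC x h1 h2)))
  have hhd : ∀ x, ContDiffAt ℝ 2 g₁ x → ContDiffAt ℝ 2 g₂ x → ∀ v,
      fderiv ℝ h x v = fderiv ℝ g₂ x v - a * fderiv ℝ g₁ x v := by
    intro x h1 h2 v
    have d1 := h1.differentiableAt two_ne_zero
    have d2 := h2.differentiableAt two_ne_zero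
    rw [hh, fderiv_fun_sub d2 (d1.const_mul a), fderiv_const_mul d1]
    simp
  have hhz : ∀ v, fderiv ℝ h z v = 0 := fun v => by
    rw [hhd z h₁ h₂, hpar]; simp
  -- The derivative of `q` in the direction `V` at `z` is the second derivative of `h` there.
  have hqV : fderiv ℝ q z V = fderiv ℝ g₁ z e *
      (fderiv ℝ (fun x => fderiv ℝ g₂ x V) z V - a * fderiv ℝ (fun x => fderiv ℝ g₁ x V) z V) := by
    have dd : ∀ {f : E → ℝ} (v : E), ContDiffAt ℝ 2 f z →
        DifferentiableAt ℝ (fun y => fderiv ℝ f y v) z := fun v hf =>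
      (hfd v hf).differentiableAt one_ne_zero
    have hz := hhC z h₁ h₂
    have e2 : fderiv ℝ (fun x => fderiv ℝ h x V) z V =
        fderiv ℝ (fun x => fderiv ℝ g₂ x V) z V
          - a * fderiv ℝ (fun x => fderiv ℝ g₁ x V) z V := by
      have : (fun x => fderiv ℝ h x V) =ᶠ[𝓝 z]
          fun x => fderiv ℝ g₂ x V - a * fderiv ℝ g₁ x V := by
        filter_upwards [hC₁, hC₂] with x h1 h2 using hhd x h1 h2 V
      rw [this.fderiv_eq, fderiv_fun_sub (dd V h₂) ((dd V h₁).const_mul a),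
        fderiv_const_mul (dd V h₁)]
      simp
    rw [hq, fderiv_fun_sub ((dd e h₁).fun_mul (dd V hz)) ((dd V h₁).fun_mul (dd e hz)),
      fderiv_fun_mul (dd e h₁) (dd V hz), fderiv_fun_mul (dd V h₁) (dd e hz), ← e2]
    simp [hhz, hV0]
  obtain ⟨U₁, hU₁, C₁, hC₁U⟩ := exists_nhds_measure_abs_le_abs_le_of_det μ
    (h₁.hasStrictFDerivAt two_ne_zero) ((hqC z h₁ h₂).hasStrictFDerivAt one_ne_zero)
    (v₁ := e) (v₂ := V) (by
      rw [hqV, hV0, zero_mul, sub_zero]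
      exact mul_ne_zero he (mul_ne_zero he (sub_ne_zero.2 hV)))
  obtain ⟨r, hr, hrU⟩ := Metric.nhds_basis_closedBall.mem_iff.1
    (inter_mem hU₁ (hC₁.and hC₂))
  refine ⟨Metric.closedBall z r, Metric.closedBall_mem_nhds z hr, fun ε hε => ?_⟩
  obtain ⟨δ, hδ, hδε⟩ : ∃ δ : ℝ, 0 < δ ∧ C₁ * δ ≤ ε / 2 := by
    refine ⟨ε / 2 / (C₁ + 1), by positivity, ?_⟩
    rw [← mul_div_assoc, div_le_iff₀ (by positivity)]
    nlinarith [C₁.coe_nonneg]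
  have hK : IsCompact {x ∈ Metric.closedBall z r | δ ≤ |q x|} := by
    have hcont : ContinuousOn (fun x => |q x|) (Metric.closedBall z r) := fun x hx =>
      ((hqC x (hrU hx).2.1 (hrU hx).2.2).continuousAt.abs).continuousWithinAt
    exact (isCompact_closedBall z r).of_isClosed_subset
      (hcont.preimage_isClosed_of_isClosed Metric.isClosed_closedBall isClosed_Ici)
      fun x hx => hx.1
  obtain ⟨C₂, hC₂K⟩ := exists_measure_abs_le_abs_le_of_isCompact μ hK (g := g₁) (h := h)
    (fun x hx => (hrU hx.1).2.1.of_le (by norm_num))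
    (fun x hx => (hhC x (hrU hx.1).2.1 (hrU hx.1).2.2).of_le (by norm_num))
    (v₁ := e) (v₂ := V) (fun x hx => by
      have := hδ.trans_le hx.2
      exact abs_pos.1 this)
  filter_upwards [eventually_mul_ofReal_mul_ofReal_le C₂ (1 + |a|) (half_pos hε),
    self_mem_nhdsWithin] with t ht ht0
  have ht0 : 0 ≤ t := ht0
  have hsub : {x ∈ Metric.closedBall z r | |g₁ x| ≤ t ∧ |g₂ x| ≤ t} ⊆
      {x ∈ U₁ | |g₁ x| ≤ t ∧ |q x| ≤ δ} ∪
        {x ∈ {x ∈ Metric.closedBall z r | δ ≤ |q x|} | |g₁ x| ≤ t ∧ |h x| ≤ (1 + |a|) * t} := by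
    rintro x ⟨hx, hx1, hx2⟩
    rcases le_total |q x| δ with hqx | hqx
    · exact Or.inl ⟨(hrU hx).1, hx1, hqx⟩
    · refine Or.inr ⟨⟨hx, hqx⟩, hx1, ?_⟩
      calc |h x| ≤ |g₂ x| + |a * g₁ x| := abs_sub _ _
        _ ≤ t + |a| * t := by
            rw [abs_mul]
            gcongr
        _ = _ := by ring
  calc _ ≤ _ := measure_mono hsub
    _ ≤ _ := measure_union_le _ _
    _ ≤ C₁ * (ENNReal.ofReal t * ENNReal.ofReal δ) +
        C₂ * (ENNReal.ofReal t * ENNReal.ofReal ((1 + |a|) * t)) :=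
      add_le_add (hC₁U t δ) (hC₂K t _)
    _ ≤ ENNReal.ofReal (ε / 2 * t) + ENNReal.ofReal (ε / 2 * t) := by
        refine add_le_add ?_ ht
        rw [← ENNReal.ofReal_coe_nnreal, ← ENNReal.ofReal_mul ht0,
          ← ENNReal.ofReal_mul C₁.coe_nonneg]
        refine ENNReal.ofReal_le_ofReal ?_
        nlinarith [mul_le_mul_of_nonneg_right hδε ht0]
    _ = _ := by
        rw [← ENNReal.ofReal_add (by positivity) (by positivity)]
        congr 1
        ring

end SublevelVolume

/-! ### Riemannian volume and Lebesgue measure in a chart -/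

section RiemannianVolume

open scoped NNReal ENNReal

variable {d : ℕ} {M : Type*} [TopologicalSpace M] [ChartedSpace (EuclideanSpace ℝ (Fin d)) M]

/-- The differential of the inverse chart at `x₀`, as a map of model spaces. -/
noncomputable def chartSymmDeriv (x₀ : M) (u : EuclideanSpace ℝ (Fin d)) :
    EuclideanSpace ℝ (Fin d) →L[ℝ] EuclideanSpace ℝ (Fin d) :=
  mfderiv (𝓡 d) (𝓡 d) (extChartAt (𝓡 d) x₀).symm u

/-- The Gram determinant of a bilinear form pulled back by `L` acquires the factor `(det L)²`. -/
theorem det_of_bilin_comp (B : LinearMap.BilinForm ℝ (EuclideanSpace ℝ (Fin d)))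
    (L : EuclideanSpace ℝ (Fin d) →L[ℝ] EuclideanSpace ℝ (Fin d)) :
    (Matrix.of fun a b => B (L (EuclideanSpace.single a 1)) (L (EuclideanSpace.single b 1))).det =
      L.det ^ 2 * (Matrix.of fun a b : Fin d =>
        B (EuclideanSpace.single a 1) (EuclideanSpace.single b 1)).det := by
  let e := (EuclideanSpace.basisFun (Fin d) ℝ).toBasis
  have h1 : ∀ B' : LinearMap.BilinForm ℝ (EuclideanSpace ℝ (Fin d)),
      (Matrix.of fun a b : Fin d =>
        B' (EuclideanSpace.single a 1) (EuclideanSpace.single b 1)) =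
      LinearMap.BilinForm.toMatrix e B' := by
    intro B'
    ext a b
    simp [e, LinearMap.BilinForm.toMatrix_apply]
  have h2 := h1 (B.comp (L : EuclideanSpace ℝ (Fin d) →ₗ[ℝ] EuclideanSpace ℝ (Fin d)) L)
  simp only [LinearMap.BilinForm.comp_apply, ContinuousLinearMap.coe_coe] at h2
  rw [h2, h1, LinearMap.BilinForm.toMatrix_comp e e, Matrix.det_mul, Matrix.det_mul,
    Matrix.det_transpose, LinearMap.det_toMatrix]
  change LinearMap.det _ * _ * LinearMap.det _ = (LinearMap.det _) ^ 2 * _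
  ring

/-- The chain rule for the inverse charts at `x₀` and `z`, which differ by the transition map. -/
theorem hasFDerivAt_chart_transition [IsManifold (𝓡 d) ∞ M] (x₀ z : M)
    {u : EuclideanSpace ℝ (Fin d)}
    (hu : u ∈ (extChartAt (𝓡 d) x₀).target)
    (hz : (extChartAt (𝓡 d) x₀).symm u ∈ (extChartAt (𝓡 d) z).source) :
    ∃ T' : EuclideanSpace ℝ (Fin d) →L[ℝ] EuclideanSpace ℝ (Fin d),
      HasFDerivAt (fun v => extChartAt (𝓡 d) z ((extChartAt (𝓡 d) x₀).symm v)) T' u ∧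
      chartSymmDeriv x₀ u =
        (chartSymmDeriv z (extChartAt (𝓡 d) z ((extChartAt (𝓡 d) x₀).symm u))).comp T' := by
  have hsymm : ∀ (x : M) (v), v ∈ (extChartAt (𝓡 d) x).target →
      MDifferentiableAt (𝓡 d) (𝓡 d) (extChartAt (𝓡 d) x).symm v := fun x v hv =>
    ((contMDiffOn_extChartAt_symm (n := ∞) x).contMDiffAt
      ((isOpen_extChartAt_target x).mem_nhds hv)).mdifferentiableAt (by simp)
  have hφ : MDifferentiableAt (𝓡 d) (𝓡 d) (extChartAt (𝓡 d) z) ((extChartAt (𝓡 d) x₀).symm u) :=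
    (contMDiffAt_extChartAt' (n := ∞) (by simpa using hz)).mdifferentiableAt (by simp)
  have hT : MDifferentiableAt (𝓡 d) (𝓡 d)
      (fun v => extChartAt (𝓡 d) z ((extChartAt (𝓡 d) x₀).symm v)) u := hφ.comp u (hsymm x₀ u hu)
  refine ⟨fderiv ℝ (fun v => extChartAt (𝓡 d) z ((extChartAt (𝓡 d) x₀).symm v)) u,
    hT.differentiableAt.hasFDerivAt, ?_⟩
  have h1 := (hsymm z _ ((extChartAt (𝓡 d) z).map_source hz)).hasMFDerivAt.comp u hT.hasMFDerivAt
  have hev : (extChartAt (𝓡 d) x₀).symm =ᶠ[𝓝 u] (extChartAt (𝓡 d) z).symm ∘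
      fun v => extChartAt (𝓡 d) z ((extChartAt (𝓡 d) x₀).symm v) := by
    have hc : ContinuousAt (extChartAt (𝓡 d) x₀).symm u := continuousAt_extChartAt_symm'' hu
    filter_upwards [hc.preimage_mem_nhds ((isOpen_extChartAt_source z).mem_nhds hz)] with v hv
    exact ((extChartAt (𝓡 d) z).left_inv hv).symm
  have h2 := (h1.congr_of_eventuallyEq hev).mfderiv
  rw [mfderiv_eq_fderiv] at h2
  exact h2

theorem ContinuousOn.measurableSet_inter_preimage {X Y : Type*} [TopologicalSpace X]
    [MeasurableSpace X] [OpensMeasurableSpace X] [TopologicalSpace Y] [MeasurableSpace Y]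
    [BorelSpace Y] {f : X → Y} {s : Set X} (hf : ContinuousOn f s) (hs : MeasurableSet s)
    {A : Set Y} (hA : MeasurableSet A) : MeasurableSet (s ∩ f ⁻¹' A) := by
  have := hs.subtype_image (hf.domRestrict.measurable hA)
  convert this using 1
  ext u
  simp [and_comm]

theorem measurableSet_symm_preimage_inter_target [MeasurableSpace M] [BorelSpace M]
    (x₀ : M) {A : Set M} (hA : MeasurableSet A) :
    MeasurableSet ((extChartAt (𝓡 d) x₀).symm ⁻¹' A ∩ (extChartAt (𝓡 d) x₀).target) := by
  rw [inter_comm]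
  exact (continuousOn_extChartAt_symm x₀).measurableSet_inter_preimage
    (isOpen_extChartAt_target x₀).measurableSet hA

variable [RiemannianBundle (fun x : M => TangentSpace (𝓡 d) x)]

/-- The Riemannian metric at `p`, as a bilinear form on the model space to which Mathlib identifies
`T_p M`. Its arguments do not depend on `p`, so that `p` can be rewritten. -/
noncomputable def metricForm (p : M) : LinearMap.BilinForm ℝ (EuclideanSpace ℝ (Fin d)) :=
  LinearMap.mk₂ ℝ (fun v w => inner (E := TangentSpace (𝓡 d) p) ℝ v w)
    (inner_add_left (E := TangentSpace (𝓡 d) p))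
    (fun a v w => real_inner_smul_left (F := TangentSpace (𝓡 d) p) v w a)
    (inner_add_right (E := TangentSpace (𝓡 d) p))
    (fun a v w => real_inner_smul_right (F := TangentSpace (𝓡 d) p) v w a)

theorem metricMatrix_apply (x₀ : M) (u : EuclideanSpace ℝ (Fin d)) (a b : Fin d) :
    metricMatrix x₀ u a b = metricForm ((extChartAt (𝓡 d) x₀).symm u)
      (chartSymmDeriv x₀ u (EuclideanSpace.single a 1))
      (chartSymmDeriv x₀ u (EuclideanSpace.single b 1)) := rfl

theorem sqrt_det_metricMatrix_eq (x₀ z : M) {u : EuclideanSpace ℝ (Fin d)}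
    {T' : EuclideanSpace ℝ (Fin d) →L[ℝ] EuclideanSpace ℝ (Fin d)}
    (hz : (extChartAt (𝓡 d) x₀).symm u ∈ (extChartAt (𝓡 d) z).source)
    (hT' : chartSymmDeriv x₀ u =
        (chartSymmDeriv z (extChartAt (𝓡 d) z ((extChartAt (𝓡 d) x₀).symm u))).comp T') :
    Real.sqrt (metricMatrix x₀ u).det = |T'.det| * Real.sqrt
      (metricMatrix z (extChartAt (𝓡 d) z ((extChartAt (𝓡 d) x₀).symm u))).det := by
  set v := extChartAt (𝓡 d) z ((extChartAt (𝓡 d) x₀).symm u) with hv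
  let B : LinearMap.BilinForm ℝ (EuclideanSpace ℝ (Fin d)) :=
    (metricForm ((extChartAt (𝓡 d) x₀).symm u)).comp (chartSymmDeriv z v).toLinearMap
      (chartSymmDeriv z v).toLinearMap
  have hp : (extChartAt (𝓡 d) z).symm v = (extChartAt (𝓡 d) x₀).symm u :=
    (extChartAt (𝓡 d) z).left_inv hz
  have h1 : metricMatrix x₀ u = Matrix.of fun a b =>
      B (T' (EuclideanSpace.single a 1)) (T' (EuclideanSpace.single b 1)) := by
    ext a b
    rw [metricMatrix_apply, hT']
    rfl
  have h2 : metricMatrix z v = Matrix.of fun a b =>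
      B (EuclideanSpace.single a 1) (EuclideanSpace.single b 1) := by
    ext a b
    rw [metricMatrix_apply, hp]
    rfl
  rw [h1, h2, det_of_bilin_comp, Real.sqrt_mul (sq_nonneg _), Real.sqrt_sq_eq_abs]

section

attribute [local instance] normedAddCommGroupTangentSpaceVectorSpace
attribute [local instance] normedSpaceTangentSpaceVectorSpace

/-- The entries of the metric matrix are bounded through the norm of the differential of the inverse
chart, which is bounded near `z` by continuity of the metric. -/
theorem exists_eventually_det_metricMatrix_le [IsManifold (𝓡 d) ∞ M]
    [IsContMDiffRiemannianBundle (𝓡 d) ∞ (EuclideanSpace ℝ (Fin d))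
      (fun x : M => TangentSpace (𝓡 d) x)] (z : M) :
    ∃ C : ℝ, ∀ᶠ u in 𝓝 (extChartAt (𝓡 d) z z), (metricMatrix z u).det ≤ C := by
  have : IsManifold (𝓡 d) 1 M := IsManifold.of_le (n := ∞) (by simp)
  have : IsContinuousRiemannianBundle (EuclideanSpace ℝ (Fin d))
      (fun x : M => TangentSpace (𝓡 d) x) := by
    obtain ⟨g, hg, h⟩ := IsContMDiffRiemannianBundle.exists_contMDiff (IB := 𝓡 d) (n := ∞)
      (F := EuclideanSpace ℝ (Fin d)) (E := fun x : M => TangentSpace (𝓡 d) x)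
    exact ⟨g, hg.continuous, h⟩
  obtain ⟨C, hC, h⟩ := eventually_norm_mfderivWithin_symm_extChartAt_lt (𝓡 d) z
  simp only [ModelWithCorners.range_eq_univ, nhdsWithin_univ, mfderivWithin_univ] at h
  refine ⟨(Fintype.card (Fin d)).factorial • (C * C) ^ Fintype.card (Fin d), ?_⟩
  filter_upwards [h] with u hu
  refine (le_abs_self _).trans (Matrix.det_le (abv := AbsoluteValue.abs) fun a b => ?_)
  have hv : ∀ a : Fin d, ‖(mfderiv (𝓡 d) (𝓡 d) (extChartAt (𝓡 d) z).symm u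
      (EuclideanSpace.single a (1 : ℝ)) :
        TangentSpace (𝓡 d) ((extChartAt (𝓡 d) z).symm u))‖ ≤ C := by
    intro a
    have h1 := ContinuousLinearMap.le_of_opNorm_le _ hu.le
      (EuclideanSpace.single a (1 : ℝ) : TangentSpace 𝓘(ℝ, EuclideanSpace ℝ (Fin d)) u)
    have h2 : ‖(EuclideanSpace.single a (1 : ℝ) : EuclideanSpace ℝ (Fin d))‖ = 1 := by simp
    exact h1.trans_eq ((congrArg (C * ·) h2).trans (mul_one C))
  exact (abs_real_inner_le_norm _ _).trans (mul_le_mul (hv a) (hv b) (norm_nonneg _) hC.le)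

end

variable [MeasurableSpace M] [BorelSpace M]

theorem chartVolume_apply (x₀ : M) {A : Set M} (hA : MeasurableSet A) :
    chartVolume (d := d) x₀ A =
      ∫⁻ u in (extChartAt (𝓡 d) x₀).symm ⁻¹' A ∩ (extChartAt (𝓡 d) x₀).target,
        ENNReal.ofReal (Real.sqrt (metricMatrix x₀ u).det) := by
  have ht := (isOpen_extChartAt_target (I := 𝓡 d) x₀).measurableSet
  have hm : AEMeasurable (extChartAt (𝓡 d) x₀).symm
      ((volume.restrict (extChartAt (𝓡 d) x₀).target).withDensity
        fun u => ENNReal.ofReal (Real.sqrt (metricMatrix x₀ u).det)) :=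
    ((continuousOn_extChartAt_symm x₀).aemeasurable ht).mono_ac
      (withDensity_absolutelyContinuous _ _)
  rw [chartVolume, Measure.map_apply_of_aemeasurable hm hA, withDensity_apply',
    Measure.restrict_restrict' ht]

variable [IsManifold (𝓡 d) ∞ M]

/-- The change of variables formula for the transition map, on the domain of the chart at `z`. -/
theorem chartVolume_le_chartVolume (x₀ z : M) {A : Set M} (hA : MeasurableSet A)
    (hAz : A ⊆ (extChartAt (𝓡 d) z).source) :
    chartVolume (d := d) x₀ A ≤ chartVolume (d := d) z A := by
  set B := (extChartAt (𝓡 d) x₀).symm ⁻¹' A ∩ (extChartAt (𝓡 d) x₀).target with hB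
  have hBm : MeasurableSet B := measurableSet_symm_preimage_inter_target x₀ hA
  have hex : ∀ u, ∃ T' : EuclideanSpace ℝ (Fin d) →L[ℝ] EuclideanSpace ℝ (Fin d), u ∈ B →
      HasFDerivAt (fun v => extChartAt (𝓡 d) z ((extChartAt (𝓡 d) x₀).symm v)) T' u ∧
      chartSymmDeriv x₀ u =
        (chartSymmDeriv z (extChartAt (𝓡 d) z ((extChartAt (𝓡 d) x₀).symm u))).comp T' := by
    intro u
    by_cases hu : u ∈ B
    · obtain ⟨T', h⟩ := hasFDerivAt_chart_transition x₀ z hu.2 (hAz hu.1)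
      exact ⟨T', fun _ => h⟩
    · exact ⟨0, fun h => absurd h hu⟩
  choose T' hT' using hex
  have hinj : InjOn (fun v => extChartAt (𝓡 d) z ((extChartAt (𝓡 d) x₀).symm v)) B := by
    intro u hu v hv huv
    exact (extChartAt (𝓡 d) x₀).symm.injOn hu.2 hv.2
      ((extChartAt (𝓡 d) z).injOn (hAz hu.1) (hAz hv.1) huv)
  rw [chartVolume_apply x₀ hA, chartVolume_apply z hA]
  calc _ = ∫⁻ u in B, ENNReal.ofReal |(T' u).det| * ENNReal.ofReal (Real.sqrt
        (metricMatrix z (extChartAt (𝓡 d) z ((extChartAt (𝓡 d) x₀).symm u))).det) := by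
        refine setLIntegral_congr_fun hBm fun u hu => ?_
        rw [← ENNReal.ofReal_mul (abs_nonneg _)]
        exact congrArg _ (sqrt_det_metricMatrix_eq x₀ z (hAz hu.1) (hT' u hu).2)
    _ = ∫⁻ v in (fun v => extChartAt (𝓡 d) z ((extChartAt (𝓡 d) x₀).symm v)) '' B,
          ENNReal.ofReal (Real.sqrt (metricMatrix z v).det) :=
        (lintegral_image_eq_lintegral_abs_det_fderiv_mul volume hBm
          (fun u hu => (hT' u hu).1.hasFDerivWithinAt) hinj
          (fun v => ENNReal.ofReal (Real.sqrt (metricMatrix z v).det))).symm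
    _ ≤ _ := by
        refine lintegral_mono_set ?_
        rintro _ ⟨u, hu, rfl⟩
        refine ⟨?_, (extChartAt (𝓡 d) z).map_source (hAz hu.1)⟩
        rw [mem_preimage, (extChartAt (𝓡 d) z).left_inv (hAz hu.1)]
        exact hu.1

/-- The supremum over all charts does not exceed the volume of one chart, on its domain: outside
of the domain the chart volume is enlarged to the top measure, and the result bounds all of the
chart volumes. -/
theorem riemannianVolume_le_chartVolume (z : M) {A : Set M}
    (hAz : A ⊆ (extChartAt (𝓡 d) z).source) :
    riemannianVolume d M A ≤ chartVolume (d := d) z A := by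
  have hs : MeasurableSet (extChartAt (𝓡 d) z).source := (isOpen_extChartAt_source z).measurableSet
  have hle : riemannianVolume d M ≤
      chartVolume (d := d) z + (⊤ : Measure M).restrict (extChartAt (𝓡 d) z).sourceᶜ := by
    refine iSup_le fun x₀ => Measure.le_iff.2 fun S hS => ?_
    rw [Measure.add_apply, Measure.restrict_apply hS, ← measure_inter_add_sdiff S hs]
    refine add_le_add ?_ ((le_top : chartVolume (d := d) x₀ ≤ ⊤) _)
    exact (chartVolume_le_chartVolume x₀ z (hS.inter hs) inter_subset_right).trans
      (measure_mono inter_subset_left)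
  refine (hle A).trans ?_
  rw [Measure.add_apply, Measure.restrict_apply' hs.compl,
    (disjoint_compl_right_iff_subset.2 hAz).inter_eq, measure_empty, add_zero]

/-- Near `z`, the Riemannian volume is at most a constant times the Lebesgue measure of the chart
at `z`. -/
theorem exists_riemannianVolume_le
    [IsContMDiffRiemannianBundle (𝓡 d) ∞ (EuclideanSpace ℝ (Fin d))
    (fun x : M => TangentSpace (𝓡 d) x)] (z : M) :
    ∃ W ∈ 𝓝 (extChartAt (𝓡 d) z z), ∃ C : ℝ≥0, ∀ A : Set M, MeasurableSet A →
      A ⊆ (extChartAt (𝓡 d) z).source → MapsTo (extChartAt (𝓡 d) z) A W →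
      riemannianVolume d M A ≤ C * volume
        ((extChartAt (𝓡 d) z).symm ⁻¹' A ∩ (extChartAt (𝓡 d) z).target) := by
  obtain ⟨C, hC⟩ := exists_eventually_det_metricMatrix_le (d := d) z
  refine ⟨_, hC, (Real.sqrt C).toNNReal, fun A hA hAz hAW => ?_⟩
  refine (riemannianVolume_le_chartVolume z hAz).trans ?_
  rw [chartVolume_apply z hA, ← setLIntegral_const]
  refine setLIntegral_mono' (measurableSet_symm_preimage_inter_target z hA) fun u hu => ?_
  refine ENNReal.ofReal_le_ofReal (Real.sqrt_le_sqrt ?_)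
  have := hAW hu.1
  rwa [mem_ofPred_eq, (extChartAt (𝓡 d) z).right_inv hu.2] at this

end RiemannianVolume

/-! ### Directional derivatives on open sets -/

section DirectionalDerivatives

variable {X : Type*} [NormedAddCommGroup X] [NormedSpace ℝ X]

/-- The derivative of `f` in the direction `v`, as a function of the point. -/
noncomputable def dirDeriv (v : X) (f : X → ℝ) : X → ℝ := fun z => fderiv ℝ f z v

variable {O : Set X} {f g : X → ℝ} {z : X}

theorem ContDiffOn.dirDeriv {m n : WithTop ℕ∞} (hf : ContDiffOn ℝ n f O) (hO : IsOpen O)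
    (hmn : m + 1 ≤ n) (v : X) : ContDiffOn ℝ m (dirDeriv v f) O :=
  (hf.fderiv_of_isOpen hO hmn).clm_apply contDiffOn_const

theorem dirDeriv_eqOn (hO : IsOpen O) (h : EqOn f g O) (v : X) :
    EqOn (dirDeriv v f) (dirDeriv v g) O := fun z hz => by
  have : f =ᶠ[𝓝 z] g := h.eventuallyEq_of_mem (hO.mem_nhds hz)
  simp only [dirDeriv, this.fderiv_eq]

theorem dirDeriv_comm (hO : IsOpen O) (hf : ContDiffOn ℝ 2 f O) (v w : X) :
    EqOn (dirDeriv v (dirDeriv w f)) (dirDeriv w (dirDeriv v f)) O := fun z hz => by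
  have hfz : ContDiffAt ℝ 2 f z := hf.contDiffAt (hO.mem_nhds hz)
  have hd : DifferentiableAt ℝ (fderiv ℝ f) z :=
    (hfz.fderiv_right (m := 1) (by norm_num)).differentiableAt one_ne_zero
  have h : ∀ v w, dirDeriv v (dirDeriv w f) z = fderiv ℝ (fderiv ℝ f) z v w := fun v w => by
    change fderiv ℝ (fun z => fderiv ℝ f z w) z v = _
    rw [fderiv_clm_apply hd (differentiableAt_const w)]
    simp
  rw [h, h]
  exact hfz.isSymmSndFDerivAt (by simp) v w

theorem dirDeriv_sum {ι : Type*} [Fintype ι] (c : ι → ℝ) (e : ι → X) (f : X → ℝ) (z : X) :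
    dirDeriv (∑ i, c i • e i) f z = ∑ i, c i * dirDeriv (e i) f z := by
  simp [dirDeriv, map_sum]

theorem dirDeriv_dirDeriv_sum {ι : Type*} [Fintype ι] (hO : IsOpen O) (hf : ContDiffOn ℝ 2 f O)
    (hz : z ∈ O) (v : X) (c : ι → ℝ) (e : ι → X) :
    dirDeriv v (dirDeriv (∑ i, c i • e i) f) z =
      ∑ i, c i * dirDeriv v (dirDeriv (e i) f) z := by
  rw [dirDeriv_comm hO hf _ _ hz, dirDeriv_sum]
  exact Finset.sum_congr rfl fun i _ => by rw [dirDeriv_comm hO hf _ _ hz]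

theorem dirDeriv_dirDeriv_dirDeriv_sum {ι : Type*} [Fintype ι] (hO : IsOpen O)
    (hf : ContDiffOn ℝ 3 f O) (hz : z ∈ O) (v w : X) (c : ι → ℝ) (e : ι → X) :
    dirDeriv v (dirDeriv w (dirDeriv (∑ i, c i • e i) f)) z =
      ∑ i, c i * dirDeriv v (dirDeriv w (dirDeriv (e i) f)) z := by
  have hsw : ∀ u, dirDeriv v (dirDeriv w (dirDeriv u f)) z =
      dirDeriv v (dirDeriv u (dirDeriv w f)) z := fun u =>
    dirDeriv_eqOn hO (dirDeriv_comm hO (hf.of_le (by norm_num)) w u) v hz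
  simp only [hsw]
  exact dirDeriv_dirDeriv_sum hO (hf.dirDeriv hO (by norm_num) w) hz v c e

theorem dirDeriv_dirDeriv_dirDeriv_dirDeriv_sum {ι : Type*} [Fintype ι] (hO : IsOpen O)
    (hf : ContDiffOn ℝ 4 f O) (hz : z ∈ O) (v w u : X) (c : ι → ℝ) (e : ι → X) :
    dirDeriv v (dirDeriv w (dirDeriv u (dirDeriv (∑ i, c i • e i) f))) z =
      ∑ i, c i * dirDeriv v (dirDeriv w (dirDeriv u (dirDeriv (e i) f))) z := by
  have hsw : ∀ t, dirDeriv v (dirDeriv w (dirDeriv u (dirDeriv t f))) z =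
      dirDeriv v (dirDeriv w (dirDeriv t (dirDeriv u f))) z := fun t =>
    dirDeriv_eqOn hO (dirDeriv_eqOn hO (dirDeriv_comm hO (hf.of_le (by norm_num)) u t) w) v hz
  simp only [hsw]
  exact dirDeriv_dirDeriv_dirDeriv_sum hO (hf.dirDeriv hO (by norm_num) u) hz v w c e

/-- The mixed fourth derivative does not change when the first two and the last two directions are
exchanged. -/
theorem dirDeriv_comm_pairs (hO : IsOpen O) (hf : ContDiffOn ℝ 4 f O) (v w : X) :
    EqOn (dirDeriv v (dirDeriv v (dirDeriv w (dirDeriv w f))))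
      (dirDeriv w (dirDeriv w (dirDeriv v (dirDeriv v f)))) O := by
  have h2 : ∀ u, ContDiffOn ℝ 3 (dirDeriv u f) O := fun u => hf.dirDeriv hO (by norm_num) u
  have h3 : ∀ u u', ContDiffOn ℝ 2 (dirDeriv u (dirDeriv u' f)) O :=
    fun u u' => (h2 u').dirDeriv hO (by norm_num) u
  have hf2 : ContDiffOn ℝ 2 f O := hf.of_le (by norm_num)
  have h22 : ∀ u, ContDiffOn ℝ 2 (dirDeriv u f) O := fun u => (h2 u).of_le (by norm_num)
  intro z hz
  calc _ = dirDeriv v (dirDeriv w (dirDeriv v (dirDeriv w f))) z :=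
        dirDeriv_eqOn hO (dirDeriv_comm hO (h22 w) v w) v hz
    _ = dirDeriv w (dirDeriv v (dirDeriv v (dirDeriv w f))) z := dirDeriv_comm hO (h3 v w) v w hz
    _ = dirDeriv w (dirDeriv v (dirDeriv w (dirDeriv v f))) z :=
        dirDeriv_eqOn hO (dirDeriv_eqOn hO (dirDeriv_comm hO hf2 v w) v) w hz
    _ = _ := dirDeriv_eqOn hO (dirDeriv_comm hO (h22 v) v w) w hz

theorem dirDeriv_comm_third (hO : IsOpen O) (hf : ContDiffOn ℝ 3 f O) (v w u : X) :
    EqOn (dirDeriv u (dirDeriv v (dirDeriv w f))) (dirDeriv v (dirDeriv w (dirDeriv u f))) O := by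
  intro z hz
  rw [dirDeriv_comm hO (hf.dirDeriv hO (by norm_num) w) u v hz]
  exact dirDeriv_eqOn hO (dirDeriv_comm hO (hf.of_le (by norm_num)) u w) v hz

/-- The second derivative of a function along a curve. -/
theorem deriv_deriv_comp (hO : IsOpen O) (hg : ContDiffOn ℝ 2 g O) {p : ℝ → X} {s₀ : ℝ}
    (hp : ContDiffAt ℝ 2 p s₀) (hz : p s₀ ∈ O) :
    deriv (fun s => g (p s)) s₀ = dirDeriv (deriv p s₀) g (p s₀) ∧
    deriv (deriv fun s => g (p s)) s₀ =
      dirDeriv (deriv p s₀) (dirDeriv (deriv p s₀) g) (p s₀)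
        + dirDeriv (deriv (deriv p) s₀) g (p s₀) := by
  have hev : ∀ᶠ s in 𝓝 s₀, ContDiffAt ℝ 2 p s ∧ p s ∈ O :=
    (hp.eventually (by simp)).and (hp.continuousAt.eventually (hO.mem_nhds hz))
  have h1 : ∀ s, ContDiffAt ℝ 2 p s ∧ p s ∈ O →
      HasDerivAt (fun s => g (p s)) (fderiv ℝ g (p s) (deriv p s)) s := fun s hs =>
    ((hg.contDiffAt (hO.mem_nhds hs.2)).differentiableAt two_ne_zero).hasFDerivAt.comp_hasDerivAt s
      (hs.1.differentiableAt two_ne_zero).hasDerivAt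
  refine ⟨(h1 s₀ hev.self_of_nhds).deriv, ?_⟩
  have h2 : deriv (fun s => g (p s)) =ᶠ[𝓝 s₀] fun s => fderiv ℝ g (p s) (deriv p s) :=
    hev.mono fun s hs => (h1 s hs).deriv
  have hgd : DifferentiableAt ℝ (fderiv ℝ g) (p s₀) :=
    ((hg.contDiffAt (hO.mem_nhds hz)).fderiv_right (m := 1) (by norm_num)).differentiableAt
      one_ne_zero
  have hpd : DifferentiableAt ℝ (deriv p) s₀ :=
    (hp.derivWithin (m := 1) (by norm_num)).differentiableAt one_ne_zero
  have h3 := (hgd.hasFDerivAt.comp_hasDerivAt s₀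
    (hp.differentiableAt two_ne_zero).hasDerivAt).clm_apply hpd.hasDerivAt
  rw [h2.deriv_eq]
  refine h3.deriv.trans ?_
  congr 1
  change _ = fderiv ℝ (fun z => fderiv ℝ g z (deriv p s₀)) (p s₀) (deriv p s₀)
  rw [fderiv_clm_apply hgd (differentiableAt_const _)]
  simp

end DirectionalDerivatives

section PartialDerivatives

variable {d : ℕ}

/-- The `i`-th coordinate direction of the first factor. -/
noncomputable def dirFst (i : Fin d) : EuclideanSpace ℝ (Fin d) × EuclideanSpace ℝ (Fin d) :=
  (EuclideanSpace.single i 1, 0)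

/-- The `p`-th coordinate direction of the second factor. -/
noncomputable def dirSnd (p : Fin d) : EuclideanSpace ℝ (Fin d) × EuclideanSpace ℝ (Fin d) :=
  (0, EuclideanSpace.single p 1)

theorem sum_smul_single (v : EuclideanSpace ℝ (Fin d)) :
    ∑ i, v i • EuclideanSpace.single i (1 : ℝ) = v := by
  ext j
  simp [Pi.single_apply]

theorem sum_smul_dirFst (v : EuclideanSpace ℝ (Fin d)) : ∑ i, v i • dirFst i = (v, 0) := by
  simp only [dirFst, Prod.smul_mk, smul_zero]
  exact Prod.ext (by simp [Prod.fst_sum, sum_smul_single]) (by simp [Prod.snd_sum])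

theorem sum_smul_dirSnd (v : EuclideanSpace ℝ (Fin d)) : ∑ i, v i • dirSnd i = (0, v) := by
  simp only [dirSnd, Prod.smul_mk, smul_zero]
  exact Prod.ext (by simp [Prod.fst_sum]) (by simp [Prod.snd_sum, sum_smul_single])

variable {O : Set (EuclideanSpace ℝ (Fin d) × EuclideanSpace ℝ (Fin d))}
  {F : EuclideanSpace ℝ (Fin d) → EuclideanSpace ℝ (Fin d) → ℝ}
  {f : EuclideanSpace ℝ (Fin d) × EuclideanSpace ℝ (Fin d) → ℝ}

theorem fderiv_slice_fst (hO : IsOpen O) (hf : ContDiffOn ℝ 1 f O)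
    (hF : EqOn (fun p => F p.1 p.2) f O) {u w} (hz : (u, w) ∈ O)
    (v : EuclideanSpace ℝ (Fin d)) :
    fderiv ℝ (fun u' => F u' w) u v = dirDeriv (v, 0) f (u, w) := by
  have hev : (fun u' => F u' w) =ᶠ[𝓝 u] fun u' => f (u', w) := by
    have hc : ContinuousAt (fun u' : EuclideanSpace ℝ (Fin d) => (u', w)) u := by fun_prop
    filter_upwards [hc.preimage_mem_nhds (hO.mem_nhds hz)] with u' hu' using hF hu'
  have h1 : HasFDerivAt (fun u' : EuclideanSpace ℝ (Fin d) => (u', w))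
      (ContinuousLinearMap.inl ℝ _ _) u := hasFDerivAt_prodMk_left u w
  have h2 := ((hf.contDiffAt (hO.mem_nhds hz)).differentiableAt one_ne_zero).hasFDerivAt.comp u h1
  rw [hev.fderiv_eq]
  exact congrArg (fun L => L v) h2.fderiv

theorem fderiv_slice_snd (hO : IsOpen O) (hf : ContDiffOn ℝ 1 f O)
    (hF : EqOn (fun p => F p.1 p.2) f O) {u w} (hz : (u, w) ∈ O)
    (v : EuclideanSpace ℝ (Fin d)) :
    fderiv ℝ (fun w' => F u w') w v = dirDeriv (0, v) f (u, w) := by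
  have hev : (fun w' => F u w') =ᶠ[𝓝 w] fun w' => f (u, w') := by
    have hc : ContinuousAt (fun w' : EuclideanSpace ℝ (Fin d) => (u, w')) w := by fun_prop
    filter_upwards [hc.preimage_mem_nhds (hO.mem_nhds hz)] with w' hw' using hF hw'
  have h1 : HasFDerivAt (fun w' : EuclideanSpace ℝ (Fin d) => (u, w'))
      (ContinuousLinearMap.inr ℝ _ _) w := hasFDerivAt_prodMk_right u w
  have h2 := ((hf.contDiffAt (hO.mem_nhds hz)).differentiableAt one_ne_zero).hasFDerivAt.comp w h1
  rw [hev.fderiv_eq]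
  exact congrArg (fun L => L v) h2.fderiv

theorem pdFst_eqOn (hO : IsOpen O) (hf : ContDiffOn ℝ 1 f O)
    (hF : EqOn (fun p => F p.1 p.2) f O) (i : Fin d) :
    EqOn (fun p => pdFst i F p.1 p.2) (dirDeriv (dirFst i) f) O := fun _ hz =>
  fderiv_slice_fst hO hf hF hz _

theorem pdSnd_eqOn (hO : IsOpen O) (hf : ContDiffOn ℝ 1 f O)
    (hF : EqOn (fun p => F p.1 p.2) f O) (i : Fin d) :
    EqOn (fun p => pdSnd i F p.1 p.2) (dirDeriv (dirSnd i) f) O := fun _ hz =>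
  fderiv_slice_snd hO hf hF hz _

end PartialDerivatives

/-! ### The Ma–Trudinger–Wang tensor through directional derivatives -/

section MTWAlgebra

variable {ι : Type*} [Fintype ι]

theorem sum_sum_contract (Z cinv : ι → ι → ℝ) (η : ι → ℝ) :
    ∑ k, ∑ l, (∑ p, ∑ q, Z p q * cinv p k * cinv q l) * η k * η l =
      ∑ p, ∑ q, Z p q * (∑ k, cinv p k * η k) * (∑ l, cinv q l * η l) := by
  calc _ = ∑ k, ∑ l, ∑ p, ∑ q, Z p q * (cinv p k * η k) * (cinv q l * η l) := by
        refine Finset.sum_congr rfl fun k _ => Finset.sum_congr rfl fun l _ => ?_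
        simp only [Finset.sum_mul]
        refine Finset.sum_congr rfl fun p _ => Finset.sum_congr rfl fun q _ => ?_
        ring
    _ = ∑ k, ∑ p, ∑ q, ∑ l, Z p q * (cinv p k * η k) * (cinv q l * η l) := by
        refine Finset.sum_congr rfl fun k _ => ?_
        rw [Finset.sum_comm]
        exact Finset.sum_congr rfl fun p _ => Finset.sum_comm
    _ = ∑ p, ∑ q, ∑ k, ∑ l, Z p q * (cinv p k * η k) * (cinv q l * η l) := by
        rw [Finset.sum_comm]
        exact Finset.sum_congr rfl fun p _ => Finset.sum_comm
    _ = _ := by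
        refine Finset.sum_congr rfl fun p _ => Finset.sum_congr rfl fun q _ => ?_
        rw [mul_assoc, Finset.sum_mul_sum, Finset.mul_sum]
        refine Finset.sum_congr rfl fun k _ => ?_
        rw [Finset.mul_sum]
        exact Finset.sum_congr rfl fun l _ => by ring

/-- The contraction of the Ma–Trudinger–Wang tensor with `b` in its last two slots, for fixed first
two slots: `X` stands for the fourth derivatives and `A`, `B` for the two kinds of third
derivatives. -/
theorem sum_sum_mul_sub_contract (X Y : ι → ι → ℝ) (A : ι → ℝ) (B : ι → ι → ι → ℝ)
    (cinv : ι → ι → ℝ) (b : ι → ℝ)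
    (hY : ∀ p q, Y p q = ∑ r, ∑ s, A r * cinv r s * B s p q) :
    ∑ p, ∑ q, -(X p q - Y p q) * b p * b q =
      -(∑ p, b p * ∑ q, b q * X p q -
        ∑ r, (∑ s, cinv r s * ∑ p, b p * ∑ q, b q * B s p q) * A r) := by
  have h1 : ∑ p, ∑ q, Y p q * b p * b q =
      ∑ r, (∑ s, cinv r s * ∑ p, b p * ∑ q, b q * B s p q) * A r := by
    calc _ = ∑ p, ∑ q, ∑ r, ∑ s, A r * cinv r s * B s p q * b p * b q := by
          refine Finset.sum_congr rfl fun p _ => Finset.sum_congr rfl fun q _ => ?_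
          rw [hY]
          simp only [Finset.sum_mul]
      _ = ∑ p, ∑ r, ∑ s, ∑ q, A r * cinv r s * B s p q * b p * b q := by
          refine Finset.sum_congr rfl fun p _ => ?_
          rw [Finset.sum_comm]
          exact Finset.sum_congr rfl fun r _ => Finset.sum_comm
      _ = ∑ r, ∑ s, ∑ p, ∑ q, A r * cinv r s * B s p q * b p * b q := by
          rw [Finset.sum_comm]
          exact Finset.sum_congr rfl fun r _ => Finset.sum_comm
      _ = _ := by
          refine Finset.sum_congr rfl fun r _ => ?_
          simp only [Finset.sum_mul, Finset.mul_sum]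
          refine Finset.sum_congr rfl fun s _ => Finset.sum_congr rfl fun p _ =>
            Finset.sum_congr rfl fun q _ => ?_
          ring
  rw [← h1, neg_sub]
  simp only [Finset.mul_sum, ← Finset.sum_sub_distrib]
  refine Finset.sum_congr rfl fun p _ => Finset.sum_congr rfl fun q _ => ?_
  ring

end MTWAlgebra

section MTWTensor

variable {d : ℕ}
  {M : Type*} [TopologicalSpace M] [ChartedSpace (EuclideanSpace ℝ (Fin d)) M]
  {N : Type*} [TopologicalSpace N] [ChartedSpace (EuclideanSpace ℝ (Fin d)) N]
  {c : M → N → ℝ} {x : M} {y : N}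
  {O : Set (EuclideanSpace ℝ (Fin d) × EuclideanSpace ℝ (Fin d))}

theorem mixedHessian_apply (hO : IsOpen O)
    (hf : ContDiffOn ℝ 4 (fun p => costInCharts c x y p.1 p.2) O)
    (hz : (extChartAt (𝓡 d) x x, extChartAt (𝓡 d) y y) ∈ O) (i p : Fin d) :
    mixedHessian d c x y i p = dirDeriv (dirFst i) (dirDeriv (dirSnd p)
      (fun p => costInCharts c x y p.1 p.2)) (extChartAt (𝓡 d) x x, extChartAt (𝓡 d) y y) :=
  pdFst_eqOn hO (hf.dirDeriv hO (by norm_num) _)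
    (pdSnd_eqOn hO (hf.of_le (by norm_num)) (fun _ _ => rfl) p) i hz

/-- The Ma–Trudinger–Wang tensor in terms of directional derivatives of the cost. The vectors `b`
and `a` are minus the first and the second derivative at `y` of the `c`-segment with direction
`η`. -/
theorem sum_mtwCoord_eq (hO : IsOpen O)
    (hf : ContDiffOn ℝ 4 (fun p => costInCharts c x y p.1 p.2) O)
    {z : EuclideanSpace ℝ (Fin d) × EuclideanSpace ℝ (Fin d)} (hz : z ∈ O)
    (hzx : z = (extChartAt (𝓡 d) x x, extChartAt (𝓡 d) y y))
    (V b a : EuclideanSpace ℝ (Fin d)) (η : Fin d → ℝ)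
    (hb : ∀ p, b p = ∑ k, (mixedHessian d c x y)⁻¹ p k * η k)
    (ha : ∀ r, a r = ∑ s, (mixedHessian d c x y)⁻¹ r s * dirDeriv (dirFst s)
      (dirDeriv (0, b) (dirDeriv (0, b) (fun p => costInCharts c x y p.1 p.2))) z) :
    ∑ i, ∑ j, ∑ k, ∑ l, mtwCoord c x y i j k l * V i * V j * η k * η l =
      -(dirDeriv (V, 0) (dirDeriv (V, 0) (dirDeriv (0, b) (dirDeriv (0, b)
          (fun p => costInCharts c x y p.1 p.2)))) z -
        dirDeriv (V, 0) (dirDeriv (V, 0) (dirDeriv (0, a)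
          (fun p => costInCharts c x y p.1 p.2))) z) := by
  set F := costInCharts (d := d) c x y with hF
  set f : EuclideanSpace ℝ (Fin d) × EuclideanSpace ℝ (Fin d) → ℝ := fun p => F p.1 p.2 with hfdef
  set H := (mixedHessian d c x y)⁻¹ with hH
  have f3 : ∀ v, ContDiffOn ℝ 3 (dirDeriv v f) O := fun v => hf.dirDeriv hO (by norm_num) v
  have f2 : ∀ v v', ContDiffOn ℝ 2 (dirDeriv v (dirDeriv v' f)) O :=
    fun v v' => (f3 v').dirDeriv hO (by norm_num) v
  have e1 : ∀ p, EqOn (fun z => pdSnd p F z.1 z.2) (dirDeriv (dirSnd p) f) O := fun p =>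
    pdSnd_eqOn hO (hf.of_le (by norm_num)) (fun _ _ => rfl) p
  have e2 : ∀ p q, EqOn (fun z => pdSnd p (pdSnd q F) z.1 z.2)
      (dirDeriv (dirSnd p) (dirDeriv (dirSnd q) f)) O := fun p q =>
    pdSnd_eqOn hO ((f3 _).of_le (by norm_num)) (e1 q) p
  have e4 : ∀ i j p q, pdFst i (pdFst j (pdSnd p (pdSnd q F))) z.1 z.2 =
      dirDeriv (dirFst i) (dirDeriv (dirFst j) (dirDeriv (dirSnd p) (dirDeriv (dirSnd q) f))) z :=
    fun i j p q => pdFst_eqOn hO ((f2 _ _).dirDeriv hO (by norm_num) _)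
      (pdFst_eqOn hO ((f2 _ _).of_le (by norm_num)) (e2 p q) j) i hz
  have e3 : ∀ i j p, pdFst i (pdFst j (pdSnd p F)) z.1 z.2 =
      dirDeriv (dirFst i) (dirDeriv (dirFst j) (dirDeriv (dirSnd p) f)) z :=
    fun i j p => pdFst_eqOn hO ((f2 _ _).of_le (by norm_num))
      (pdFst_eqOn hO ((f3 _).of_le (by norm_num)) (e1 p) j) i hz
  have e3' : ∀ s p q, pdFst s (pdSnd p (pdSnd q F)) z.1 z.2 =
      dirDeriv (dirFst s) (dirDeriv (dirSnd p) (dirDeriv (dirSnd q) f)) z :=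
    fun s p q => pdFst_eqOn hO ((f2 _ _).of_le (by norm_num)) (e2 p q) s hz
  have hm : ∀ i j k l, mtwCoord c x y i j k l = ∑ p, ∑ q,
      -(dirDeriv (dirFst i) (dirDeriv (dirFst j) (dirDeriv (dirSnd p) (dirDeriv (dirSnd q) f))) z -
        ∑ r, ∑ s, dirDeriv (dirFst i) (dirDeriv (dirFst j) (dirDeriv (dirSnd r) f)) z * H r s *
          dirDeriv (dirFst s) (dirDeriv (dirSnd p) (dirDeriv (dirSnd q) f)) z) *
      H p k * H q l := by
    intro i j k l
    simp only [← e4, ← e3, ← e3']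
    rw [hzx]
    rfl
  obtain ⟨h, hh⟩ : ∃ h : Fin d → Fin d → ℝ, ∀ p k, H p k = h p k := ⟨_, fun _ _ => rfl⟩
  simp only [hh] at hb ha hm
  -- Expansion of the directional derivatives along `V` and `b` in coordinates.
  have hYb : ∀ s, dirDeriv (dirFst s) (dirDeriv (0, b) (dirDeriv (0, b) f)) z =
      ∑ p, b p *
        ∑ q, b q * dirDeriv (dirFst s) (dirDeriv (dirSnd p) (dirDeriv (dirSnd q) f)) z := by
    intro s
    rw [← sum_smul_dirSnd b, dirDeriv_dirDeriv_sum hO ((f3 _).of_le (by norm_num)) hz]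
    refine Finset.sum_congr rfl fun p _ => ?_
    rw [dirDeriv_dirDeriv_dirDeriv_sum hO (hf.of_le (by norm_num)) hz]
  have hVV : ∀ g, ContDiffOn ℝ 2 g O → dirDeriv (V, 0) (dirDeriv (V, 0) g) z =
      ∑ i, V i * ∑ j, V j * dirDeriv (dirFst i) (dirDeriv (dirFst j) g) z := by
    intro g hg
    rw [← sum_smul_dirFst V, dirDeriv_sum]
    refine Finset.sum_congr rfl fun p _ => ?_
    rw [dirDeriv_dirDeriv_sum hO hg hz]
  have h4 : ∀ i j, dirDeriv (dirFst i) (dirDeriv (dirFst j)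
        (dirDeriv (0, b) (dirDeriv (0, b) f))) z =
      ∑ p, b p * ∑ q, b q * dirDeriv (dirFst i) (dirDeriv (dirFst j)
        (dirDeriv (dirSnd p) (dirDeriv (dirSnd q) f))) z := by
    intro i j
    rw [← sum_smul_dirSnd b, dirDeriv_dirDeriv_dirDeriv_sum hO (f3 _) hz]
    refine Finset.sum_congr rfl fun p _ => ?_
    rw [dirDeriv_dirDeriv_dirDeriv_dirDeriv_sum hO hf hz]
  have h3 : ∀ i j, dirDeriv (dirFst i) (dirDeriv (dirFst j) (dirDeriv (0, a) f)) z =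
      ∑ r, a r * dirDeriv (dirFst i) (dirDeriv (dirFst j) (dirDeriv (dirSnd r) f)) z := by
    intro i j
    rw [← sum_smul_dirSnd a, dirDeriv_dirDeriv_dirDeriv_sum hO (hf.of_le (by norm_num)) hz]
  have key : ∀ i j, ∑ k, ∑ l, mtwCoord c x y i j k l * η k * η l =
      -(dirDeriv (dirFst i) (dirDeriv (dirFst j) (dirDeriv (0, b) (dirDeriv (0, b) f))) z -
        dirDeriv (dirFst i) (dirDeriv (dirFst j) (dirDeriv (0, a) f)) z) := by
    intro i j
    simp only [hm]
    rw [sum_sum_contract]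
    simp only [← hb]
    rw [sum_sum_mul_sub_contract _ _ _ _ _ _ (fun p q => rfl), h4, h3]
    simp only [ha, hYb]
  rw [hVV _ (f2 _ _), hVV _ ((f3 _).of_le (by norm_num)), ← Finset.sum_sub_distrib,
    ← Finset.sum_neg_distrib]
  refine Finset.sum_congr rfl fun i _ => ?_
  rw [← mul_sub, ← Finset.sum_sub_distrib, ← mul_neg, ← Finset.sum_neg_distrib, Finset.mul_sum]
  refine Finset.sum_congr rfl fun j _ => ?_
  rw [← mul_sub, ← mul_neg, ← key, Finset.mul_sum, Finset.mul_sum]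
  refine Finset.sum_congr rfl fun k _ => ?_
  rw [Finset.mul_sum, Finset.mul_sum]
  exact Finset.sum_congr rfl fun l _ => by ring

end MTWTensor

/-! ### Second derivatives along `c`-segments, in charts -/

section CSegmentInCharts

variable {d : ℕ} {O : Set (EuclideanSpace ℝ (Fin d) × EuclideanSpace ℝ (Fin d))}
  {f : EuclideanSpace ℝ (Fin d) × EuclideanSpace ℝ (Fin d) → ℝ}

/-- A continuous curve in the second variable along which `-∂_i f` is affine is of class `C²`, by
the inverse function theorem. -/
theorem contDiffAt_of_dirDeriv_affine (hO : IsOpen O) (hf : ContDiffOn ℝ 4 f O)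
    {u : EuclideanSpace ℝ (Fin d)} {w : ℝ → EuclideanSpace ℝ (Fin d)} {s₀ : ℝ} (hz : (u, w s₀) ∈ O)
    {H : Matrix (Fin d) (Fin d) ℝ} (hH : IsUnit H)
    (hHf : ∀ i p, H i p = dirDeriv (dirFst i) (dirDeriv (dirSnd p) f) (u, w s₀))
    (hw : ContinuousAt w s₀) {α η : Fin d → ℝ}
    (hseg : ∀ᶠ s in 𝓝 s₀, ∀ i, -dirDeriv (dirFst i) f (u, w s) = α i + s * η i) :
    ContDiffAt ℝ 2 w s₀ := by
  let G : EuclideanSpace ℝ (Fin d) → Fin d → ℝ := fun w' i => -dirDeriv (dirFst i) f (u, w')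
  have hD : ∀ i, ContDiffAt ℝ 2 (dirDeriv (dirFst i) f) (u, w s₀) := fun i =>
    (hf.dirDeriv hO (by norm_num) _).contDiffAt (hO.mem_nhds hz)
  have hG : ContDiffAt ℝ 2 G (w s₀) := by
    refine contDiffAt_pi.2 fun i => ?_
    exact (ContDiffAt.comp (w s₀) (hD i) (contDiffAt_const.prodMk contDiffAt_id)).neg
  have hGd : ∀ v i, fderiv ℝ G (w s₀) v i = -∑ p, H i p * v p := by
    intro v i
    have h1 : HasFDerivAt (fun w' : EuclideanSpace ℝ (Fin d) => (u, w'))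
        (ContinuousLinearMap.inr ℝ _ _) (w s₀) := hasFDerivAt_prodMk_right u (w s₀)
    have h2 := (((hD i).differentiableAt two_ne_zero).hasFDerivAt.comp (w s₀) h1).neg
    have h3 := hasFDerivAt_pi'.1 (hG.differentiableAt two_ne_zero).hasFDerivAt i
    have h4 := congrArg (fun L => L v) (h3.unique h2)
    refine h4.trans ?_
    change -dirDeriv (0, v) (dirDeriv (dirFst i) f) (u, w s₀) = _
    rw [← sum_smul_dirSnd, dirDeriv_sum]
    congr 1
    refine Finset.sum_congr rfl fun p _ => ?_
    rw [hHf, mul_comm, dirDeriv_comm hO (hf.of_le (by norm_num)) _ _ hz]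
  have hinj : Function.Injective (fderiv ℝ G (w s₀)) := by
    refine (injective_iff_map_eq_zero _).2 fun v hv => ?_
    have h0 : H.mulVec (fun p => v p) = H.mulVec 0 := by
      rw [Matrix.mulVec_zero]
      ext i
      have := hGd v i
      rw [hv] at this
      simpa [Matrix.mulVec, dotProduct] using this.symm
    have := Matrix.mulVec_injective_of_isUnit hH h0
    ext p
    exact congrFun this p
  let L : EuclideanSpace ℝ (Fin d) ≃L[ℝ] (Fin d → ℝ) :=
    (LinearMap.linearEquivOfInjective (fderiv ℝ G (w s₀)).toLinearMap hinj
      (by simp)).toContinuousLinearEquiv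
  have hL : HasFDerivAt G (L : EuclideanSpace ℝ (Fin d) →L[ℝ] (Fin d → ℝ)) (w s₀) :=
    (hG.differentiableAt two_ne_zero).hasFDerivAt.congr_fderiv
      (ContinuousLinearMap.ext fun _ => rfl)
  have hinv := hG.to_localInverse hL two_ne_zero
  have hleft : ∀ᶠ w' in 𝓝 (w s₀), hG.localInverse hL two_ne_zero (G w') = w' :=
    (hG.hasStrictFDerivAt' hL two_ne_zero).eventually_left_inverse
  have hGs : (fun s => G (w s)) =ᶠ[𝓝 s₀] fun s i => α i + s * η i := by
    filter_upwards [hseg] with s hs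
    ext i
    exact hs i
  have hev : w =ᶠ[𝓝 s₀] fun s => hG.localInverse hL two_ne_zero (fun i => α i + s * η i) := by
    filter_upwards [hw.eventually hleft, hGs] with s h1 h2
    rw [← h2, h1]
  refine ContDiffAt.congr_of_eventuallyEq ?_ hev
  have haff : ContDiffAt ℝ 2 (fun (s : ℝ) i => α i + s * η i) s₀ :=
    contDiffAt_pi.2 fun i => by fun_prop
  refine ContDiffAt.comp s₀ ?_ haff
  have hpt : G (w s₀) = fun i => α i + s₀ * η i := hGs.self_of_nhds
  rw [hpt] at hinv
  exact hinv

variable {M : Type*} [TopologicalSpace M] [ChartedSpace (EuclideanSpace ℝ (Fin d)) M]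
  {N : Type*} [TopologicalSpace N] [ChartedSpace (EuclideanSpace ℝ (Fin d)) N]
  {c : M → N → ℝ} {x : M} {y : N}

/-- The second derivative of `-D²_x c(x, ·)(V, V)` along the `c`-segment with direction `η` is the
Ma–Trudinger–Wang tensor. -/
theorem deriv_deriv_along_cSegment (hO : IsOpen O)
    (hf : ContDiffOn ℝ 4 (fun p => costInCharts c x y p.1 p.2) O)
    (hz : (extChartAt (𝓡 d) x x, extChartAt (𝓡 d) y y) ∈ O)
    (hH : IsUnit (mixedHessian d c x y)) {w : ℝ → EuclideanSpace ℝ (Fin d)} {s₀ : ℝ}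
    (hw₀ : w s₀ = extChartAt (𝓡 d) y y) (hw : ContinuousAt w s₀) {α η : Fin d → ℝ}
    (hseg : ∀ᶠ s in 𝓝 s₀, ∀ i, -dirDeriv (dirFst i) (fun p => costInCharts c x y p.1 p.2)
      (extChartAt (𝓡 d) x x, w s) = α i + s * η i) (V : EuclideanSpace ℝ (Fin d)) :
    deriv (deriv fun s => -dirDeriv (V, 0) (dirDeriv (V, 0)
      (fun p => costInCharts c x y p.1 p.2)) (extChartAt (𝓡 d) x x, w s)) s₀ =
    ∑ i, ∑ j, ∑ k, ∑ l, mtwCoord c x y i j k l * V i * V j * η k * η l := by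
  set f : EuclideanSpace ℝ (Fin d) × EuclideanSpace ℝ (Fin d) → ℝ :=
    fun p => costInCharts c x y p.1 p.2 with hfdef
  set u := extChartAt (𝓡 d) x x with hu
  have hz' : (u, w s₀) ∈ O := by rwa [hw₀]
  have hHf : ∀ i p, mixedHessian d c x y i p =
      dirDeriv (dirFst i) (dirDeriv (dirSnd p) f) (u, w s₀) := fun i p => by
    rw [hw₀, mixedHessian_apply hO hf hz]
  have hwC : ContDiffAt ℝ 2 w s₀ :=
    contDiffAt_of_dirDeriv_affine hO hf hz' hH hHf hw hseg
  have f3 : ∀ v, ContDiffOn ℝ 3 (dirDeriv v f) O := fun v => hf.dirDeriv hO (by norm_num) v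
  have f2 : ∀ v v', ContDiffOn ℝ 2 (dirDeriv v (dirDeriv v' f)) O :=
    fun v v' => (f3 v').dirDeriv hO (by norm_num) v
  have f2' : ∀ v, ContDiffOn ℝ 2 (dirDeriv v f) O := fun v => (f3 v).of_le (by norm_num)
  -- The curve in the product, with its first two derivatives `(0, -b)` and `(0, -a)`.
  have hpC : ContDiffAt ℝ 2 (fun s => (u, w s)) s₀ := contDiffAt_const.prodMk hwC
  have hp1 : deriv (fun s => (u, w s)) =ᶠ[𝓝 s₀] fun s => (0, deriv w s) := by
    filter_upwards [hwC.eventually (by simp)] with s hs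
    exact ((hasDerivAt_const s u).prodMk (hs.differentiableAt two_ne_zero).hasDerivAt).deriv
  have hp2 : deriv (deriv fun s => (u, w s)) s₀ = (0, deriv (deriv w) s₀) := by
    rw [hp1.deriv_eq]
    exact ((hasDerivAt_const s₀ 0).prodMk ((hwC.derivWithin (m := 1)
      (by norm_num)).differentiableAt one_ne_zero).hasDerivAt).deriv
  set b := -deriv w s₀ with hb
  set a := -deriv (deriv w) s₀ with ha
  have hpb : deriv (fun s => (u, w s)) s₀ = -(0, b) := by
    rw [hp1.self_of_nhds, hb]; simp
  have hpa : deriv (deriv fun s => (u, w s)) s₀ = -(0, a) := by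
    rw [hp2, ha]; simp
  have hneg : ∀ v (g : EuclideanSpace ℝ (Fin d) × EuclideanSpace ℝ (Fin d) → ℝ),
      dirDeriv (-v) g = fun z => -dirDeriv v g z := fun v g => by
    ext z; simp [dirDeriv]
  have hneg2 : ∀ v (g : EuclideanSpace ℝ (Fin d) × EuclideanSpace ℝ (Fin d) → ℝ),
      dirDeriv (-v) (dirDeriv (-v) g) = dirDeriv v (dirDeriv v g) := fun v g => by
    rw [hneg, hneg v g]
    ext z
    change -fderiv ℝ (fun z => -dirDeriv v g z) z v = _
    rw [fderiv_fun_neg]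
    simp [dirDeriv]
  have hcurve : ∀ g, ContDiffOn ℝ 2 g O →
      deriv (fun s => -g (u, w s)) s₀ = dirDeriv (0, b) g (u, w s₀) ∧
      deriv (deriv fun s => -g (u, w s)) s₀ =
        -(dirDeriv (0, b) (dirDeriv (0, b) g) (u, w s₀) - dirDeriv (0, a) g (u, w s₀)) := by
    intro g hg
    obtain ⟨h1, h2⟩ := deriv_deriv_comp hO hg hpC hz'
    rw [hpb, hneg] at h1
    rw [hpb, hneg2, hpa, hneg] at h2
    constructor
    · rw [deriv.fun_neg, h1, neg_neg]
    · have : (deriv fun s => -g (u, w s)) = fun s => -deriv (fun s => g (u, w s)) s := by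
        ext s
        rw [deriv.fun_neg]
      rw [this, deriv.fun_neg, h2]
      ring
  -- Differentiating the equation of the `c`-segment once and twice determines `b` and `a`.
  have hderiv : ∀ i, dirDeriv (0, b) (dirDeriv (dirFst i) f) (u, w s₀) = η i ∧
      dirDeriv (0, b) (dirDeriv (0, b) (dirDeriv (dirFst i) f)) (u, w s₀) =
        dirDeriv (0, a) (dirDeriv (dirFst i) f) (u, w s₀) := by
    intro i
    obtain ⟨h1, h2⟩ := hcurve _ (f2' (dirFst i))
    have hev : (fun s => -dirDeriv (dirFst i) f (u, w s)) =ᶠ[𝓝 s₀] fun s => α i + s * η i :=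
      hseg.mono fun s hs => hs i
    have hd : ∀ s, deriv (fun s => α i + s * η i) s = η i := fun s => by
      have := ((hasDerivAt_id s).mul_const (η i)).const_add (α i)
      simpa only [one_mul, id_eq] using this.deriv
    rw [hev.deriv_eq, hd] at h1
    rw [hev.deriv.deriv_eq, show deriv (fun s => α i + s * η i) = fun _ => η i from funext hd,
      deriv_const] at h2
    exact ⟨h1.symm, by linarith⟩
  have hHv : ∀ (v : EuclideanSpace ℝ (Fin d)) i, (mixedHessian d c x y).mulVec (fun p => v p) i =
      dirDeriv (0, v) (dirDeriv (dirFst i) f) (u, w s₀) := by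
    intro v i
    rw [← sum_smul_dirSnd v, dirDeriv_sum, Matrix.mulVec, dotProduct]
    refine Finset.sum_congr rfl fun p _ => ?_
    rw [hHf, dirDeriv_comm hO (hf.of_le (by norm_num)) _ _ hz', mul_comm]
  have hdet : IsUnit (mixedHessian d c x y).det := (Matrix.isUnit_iff_isUnit_det _).1 hH
  have hsolve : ∀ (v : EuclideanSpace ℝ (Fin d)) p, v p = ∑ k, (mixedHessian d c x y)⁻¹ p k *
      dirDeriv (0, v) (dirDeriv (dirFst k) f) (u, w s₀) := by
    intro v p
    have h1 : (mixedHessian d c x y)⁻¹.mulVec ((mixedHessian d c x y).mulVec fun p => v p) =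
        fun p => v p := by
      rw [Matrix.mulVec_mulVec, Matrix.nonsing_inv_mul _ hdet, Matrix.one_mulVec]
    rw [← congrFun h1 p, Matrix.mulVec, dotProduct]
    exact Finset.sum_congr rfl fun k _ => by rw [hHv]
  rw [sum_mtwCoord_eq hO hf hz' (by rw [hw₀]) V b a η
    (fun p => (hsolve b p).trans (Finset.sum_congr rfl fun k _ => by rw [(hderiv k).1]))
    (fun r => (hsolve a r).trans (Finset.sum_congr rfl fun s _ => by
      rw [← (hderiv s).2]
      rw [dirDeriv_comm_third hO (hf.of_le (by norm_num)) (0, b) (0, b) (dirFst s) hz'])),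
    (hcurve _ (f2 (V, 0) (V, 0))).2, dirDeriv_comm_pairs hO hf _ _ hz',
    dirDeriv_comm_third hO (hf.of_le (by norm_num)) (V, 0) (V, 0) (0, a) hz']

end CSegmentInCharts

/-! ### Regularity of the cost in a chart -/

section CostInChart

variable {d : ℕ}
  {M : Type*} [TopologicalSpace M] [ChartedSpace (EuclideanSpace ℝ (Fin d)) M]
  {N : Type*} [TopologicalSpace N] [ChartedSpace (EuclideanSpace ℝ (Fin d)) N]
  {c : M → N → ℝ} {A : Set M} {B : Set N}

/-- The differential of `c(·, y)` in the chart at `z`, at the point with coordinates `u`. -/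
noncomputable def costGrad (c : M → N → ℝ) (z : M) (u : EuclideanSpace ℝ (Fin d)) (y : N) :
    EuclideanSpace ℝ (Fin d) →L[ℝ] ℝ :=
  fderiv ℝ (fun u' => c ((extChartAt (𝓡 d) z).symm u') y) u

/-- The second derivative of `c(·, y)` at `z` in the direction `V`, in the chart at `z`. -/
noncomputable def costSecond (c : M → N → ℝ) (z : M) (V : EuclideanSpace ℝ (Fin d)) (y : N) : ℝ :=
  fderiv ℝ (fun u => costGrad c z u y V) (extChartAt (𝓡 d) z z) V

/-- Near a point of `A × B`, the cost in charts is `C⁴` on an open set. -/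
theorem exists_isOpen_contDiffOn_costInCharts [IsManifold (𝓡 d) ∞ M] [IsManifold (𝓡 d) ∞ N]
    (hreg : IsSmoothUpToBoundary ((𝓡 d).prod (𝓡 d)) 4 (fun z : M × N => c z.1 z.2) (A ×ˢ B))
    {x : M} (hx : x ∈ A) {y : N} (hy : y ∈ B) :
    ∃ O : Set (EuclideanSpace ℝ (Fin d) × EuclideanSpace ℝ (Fin d)), IsOpen O ∧
      (extChartAt (𝓡 d) x x, extChartAt (𝓡 d) y y) ∈ O ∧
      ContDiffOn ℝ 4 (fun p => costInCharts c x y p.1 p.2) O := by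
  obtain ⟨U, hU, hAB, hc⟩ := hreg
  have h1 : ContMDiffAt ((𝓡 d).prod (𝓡 d)) 𝓘(ℝ, ℝ) 4 (fun z : M × N => c z.1 z.2) (x, y) :=
    hc.contMDiffAt (hU.mem_nhds (hAB ⟨hx, hy⟩))
  have hsx : ContMDiffAt (𝓡 d) (𝓡 d) 4 (extChartAt (𝓡 d) x).symm (extChartAt (𝓡 d) x x) :=
    ((contMDiffOn_extChartAt_symm (n := ∞) x).contMDiffAt
      (extChartAt_target_mem_nhds x)).of_le (by norm_cast)
  have hsy : ContMDiffAt (𝓡 d) (𝓡 d) 4 (extChartAt (𝓡 d) y).symm (extChartAt (𝓡 d) y y) :=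
    ((contMDiffOn_extChartAt_symm (n := ∞) y).contMDiffAt
      (extChartAt_target_mem_nhds y)).of_le (by norm_cast)
  have h2 : ContMDiffAt ((𝓡 d).prod (𝓡 d)) ((𝓡 d).prod (𝓡 d)) 4
      (fun p : EuclideanSpace ℝ (Fin d) × EuclideanSpace ℝ (Fin d) =>
        ((extChartAt (𝓡 d) x).symm p.1, (extChartAt (𝓡 d) y).symm p.2))
      (extChartAt (𝓡 d) x x, extChartAt (𝓡 d) y y) :=
    (ContMDiffAt.comp (extChartAt (𝓡 d) x x, extChartAt (𝓡 d) y y) hsx contMDiffAt_fst).prodMk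
      (ContMDiffAt.comp (extChartAt (𝓡 d) x x, extChartAt (𝓡 d) y y) hsy contMDiffAt_snd)
  have h3 : ContMDiffAt ((𝓡 d).prod (𝓡 d)) 𝓘(ℝ, ℝ) 4
      (fun p : EuclideanSpace ℝ (Fin d) × EuclideanSpace ℝ (Fin d) => costInCharts c x y p.1 p.2)
      (extChartAt (𝓡 d) x x, extChartAt (𝓡 d) y y) :=
    ContMDiffAt.comp (extChartAt (𝓡 d) x x, extChartAt (𝓡 d) y y) (by simpa using h1) h2
  rw [← modelWithCornersSelf_prod, chartedSpaceSelf_prod] at h3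
  have h4 := h3.contDiffAt
  obtain ⟨O, hOs, hO, hzO⟩ := mem_nhds_iff.1 (h4.eventually (by simp))
  refine ⟨O, hO, hzO, fun p hp => ContDiffAt.contDiffWithinAt ?_⟩
  exact hOs hp

theorem costGrad_apply_eq
    {O : Set (EuclideanSpace ℝ (Fin d) × EuclideanSpace ℝ (Fin d))} (hO : IsOpen O)
    {z : M} {y₀ y : N} (hf : ContDiffOn ℝ 4 (fun p => costInCharts c z y₀ p.1 p.2) O)
    (hy : y ∈ (extChartAt (𝓡 d) y₀).source) {u : EuclideanSpace ℝ (Fin d)}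
    (hu : (u, extChartAt (𝓡 d) y₀ y) ∈ O) (v : EuclideanSpace ℝ (Fin d)) :
    costGrad c z u y v = dirDeriv (v, 0) (fun p => costInCharts c z y₀ p.1 p.2)
      (u, extChartAt (𝓡 d) y₀ y) := by
  rw [← fderiv_slice_fst (F := costInCharts c z y₀) hO (hf.of_le (by norm_num))
    (fun _ _ => rfl) hu v]
  simp only [costInCharts, (extChartAt (𝓡 d) y₀).left_inv hy]
  rfl

theorem costSecond_eq
    {O : Set (EuclideanSpace ℝ (Fin d) × EuclideanSpace ℝ (Fin d))} (hO : IsOpen O)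
    {z : M} {y₀ y : N} (hf : ContDiffOn ℝ 4 (fun p => costInCharts c z y₀ p.1 p.2) O)
    (hy : y ∈ (extChartAt (𝓡 d) y₀).source)
    (hu : (extChartAt (𝓡 d) z z, extChartAt (𝓡 d) y₀ y) ∈ O) (V : EuclideanSpace ℝ (Fin d)) :
    costSecond c z V y = dirDeriv (V, 0) (dirDeriv (V, 0)
      (fun p => costInCharts c z y₀ p.1 p.2)) (extChartAt (𝓡 d) z z, extChartAt (𝓡 d) y₀ y) := by
  rw [← fderiv_slice_fst (F := fun u w => fderiv ℝ (fun u' => costInCharts c z y₀ u' w) u V) hO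
    (hf.dirDeriv hO (by norm_num) (V, 0)) (fun p hp => fderiv_slice_fst hO
      (hf.of_le (by norm_num)) (fun _ _ => rfl) hp V) hu V]
  simp only [costInCharts, (extChartAt (𝓡 d) y₀).left_inv hy]
  rfl

/-- The cost is differentiable in its first variable at the points of `A × B`, so that `costDFst` is
the true differential there. -/
theorem mdifferentiableAt_cost
    (hreg : IsSmoothUpToBoundary ((𝓡 d).prod (𝓡 d)) 4 (fun z : M × N => c z.1 z.2) (A ×ˢ B))
    {x : M} (hx : x ∈ A) {y : N} (hy : y ∈ B) :
    MDifferentiableAt (𝓡 d) 𝓘(ℝ, ℝ) (fun x' => c x' y) x := by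
  obtain ⟨U, hU, hAB, hc⟩ := hreg
  have h1 : ContMDiffAt ((𝓡 d).prod (𝓡 d)) 𝓘(ℝ, ℝ) 4 (fun z : M × N => c z.1 z.2) (x, y) :=
    hc.contMDiffAt (hU.mem_nhds (hAB ⟨hx, hy⟩))
  exact (ContMDiffAt.comp x h1 (contMDiffAt_id.prodMk contMDiffAt_const)).mdifferentiableAt
    (by norm_num)

theorem costGrad_eq_costDFst_comp [IsManifold (𝓡 d) ∞ M]
    (hreg : IsSmoothUpToBoundary ((𝓡 d).prod (𝓡 d)) 4 (fun z : M × N => c z.1 z.2) (A ×ˢ B))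
    {z x : M} (hx : x ∈ A)
    (hxz : x ∈ (extChartAt (𝓡 d) z).source) {y : N} (hy : y ∈ B) :
    costGrad c z (extChartAt (𝓡 d) z x) y =
      ContinuousLinearMap.comp (costDFst (d := d) c x y : EuclideanSpace ℝ (Fin d) →L[ℝ] ℝ)
        (chartSymmDeriv z (extChartAt (𝓡 d) z x)) := by
  have h1 := (mdifferentiableAt_cost hreg hx hy).hasMFDerivAt
  have h2 : MDifferentiableAt (𝓡 d) (𝓡 d) (extChartAt (𝓡 d) z).symm (extChartAt (𝓡 d) z x) :=
    ((contMDiffOn_extChartAt_symm (n := ∞) z).contMDiffAt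
      ((isOpen_extChartAt_target z).mem_nhds
        ((extChartAt (𝓡 d) z).map_source hxz))).mdifferentiableAt (by simp)
  have hp : (extChartAt (𝓡 d) z).symm (extChartAt (𝓡 d) z x) = x :=
    (extChartAt (𝓡 d) z).left_inv hxz
  have h3 := (HasMFDerivAt.comp (extChartAt (𝓡 d) z x) (by rw [hp]; exact h1)
    h2.hasMFDerivAt).mfderiv
  rw [mfderiv_eq_fderiv] at h3
  exact h3

theorem costDFst_eq_costGrad
    (hreg : IsSmoothUpToBoundary ((𝓡 d).prod (𝓡 d)) 4 (fun z : M × N => c z.1 z.2) (A ×ˢ B))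
    {z : M} (hz : z ∈ A) {y : N} (hy : y ∈ B) :
    (costDFst (d := d) c z y : EuclideanSpace ℝ (Fin d) →L[ℝ] ℝ) =
      costGrad c z (extChartAt (𝓡 d) z z) y := by
  refine (mdifferentiableAt_cost hreg hz hy).mfderiv.trans ?_
  have hr : range (𝓡 d) = univ := ModelWithCorners.range_eq_univ _
  refine (congrArg (fun S => fderivWithin ℝ (fun u' => c ((extChartAt (𝓡 d) z).symm u') y) S
    (extChartAt (𝓡 d) z z)) hr).trans ?_
  rw [fderivWithin_univ]
  rfl

variable [IsManifold (𝓡 d) ∞ M] [IsManifold (𝓡 d) ∞ N]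

theorem continuousAt_costGrad
    (hreg : IsSmoothUpToBoundary ((𝓡 d).prod (𝓡 d)) 4 (fun z : M × N => c z.1 z.2) (A ×ˢ B))
    {z : M} (hz : z ∈ A) {y₀ : N} (hy₀ : y₀ ∈ B) :
    ContinuousAt (fun p : EuclideanSpace ℝ (Fin d) × N => costGrad c z p.1 p.2)
      (extChartAt (𝓡 d) z z, y₀) := by
  obtain ⟨O, hO, hzO, hf⟩ := exists_isOpen_contDiffOn_costInCharts hreg hz hy₀
  have hm : ContinuousAt (fun p : EuclideanSpace ℝ (Fin d) × N => (p.1, extChartAt (𝓡 d) y₀ p.2))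
      (extChartAt (𝓡 d) z z, y₀) :=
    continuousAt_fst.prodMk
      (ContinuousAt.comp (x := (extChartAt (𝓡 d) z z, y₀)) (continuousAt_extChartAt y₀)
        continuousAt_snd)
  have hfd : ContinuousAt (fderiv ℝ fun p => costInCharts c z y₀ p.1 p.2)
      (extChartAt (𝓡 d) z z, extChartAt (𝓡 d) y₀ y₀) :=
    (hf.contDiffAt (hO.mem_nhds hzO)).continuousAt_fderiv (by norm_num)
  have hc : ContinuousAt (fun p : EuclideanSpace ℝ (Fin d) × N =>
      (fderiv ℝ (fun p => costInCharts c z y₀ p.1 p.2) (p.1, extChartAt (𝓡 d) y₀ p.2)).comp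
        (ContinuousLinearMap.inl ℝ _ _)) (extChartAt (𝓡 d) z z, y₀) :=
    (ContinuousAt.comp (x := (extChartAt (𝓡 d) z z, y₀)) hfd hm).clm_comp continuousAt_const
  refine hc.congr ?_
  filter_upwards [hm.preimage_mem_nhds (hO.mem_nhds hzO),
    continuousAt_snd.preimage_mem_nhds (extChartAt_source_mem_nhds (I := 𝓡 d) y₀)] with p hp hp'
  ext v
  exact (costGrad_apply_eq hO hf hp' hp v).symm

theorem continuousOn_costSecond
    (hreg : IsSmoothUpToBoundary ((𝓡 d).prod (𝓡 d)) 4 (fun z : M × N => c z.1 z.2) (A ×ˢ B))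
    {z : M} (hz : z ∈ A) (V : EuclideanSpace ℝ (Fin d)) :
    ContinuousOn (costSecond c z V) B := by
  intro y₀ hy₀
  refine ContinuousAt.continuousWithinAt ?_
  obtain ⟨O, hO, hzO, hf⟩ := exists_isOpen_contDiffOn_costInCharts hreg hz hy₀
  have hm : ContinuousAt (fun y : N => (extChartAt (𝓡 d) z z, extChartAt (𝓡 d) y₀ y)) y₀ :=
    continuousAt_const.prodMk (continuousAt_extChartAt y₀)
  have hfd : ContinuousAt (dirDeriv (V, 0) (dirDeriv (V, 0) fun p => costInCharts c z y₀ p.1 p.2))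
      (extChartAt (𝓡 d) z z, extChartAt (𝓡 d) y₀ y₀) :=
    (((hf.dirDeriv (m := 3) hO (by norm_num) _).dirDeriv (m := 2) hO
      (by norm_num) _).continuousOn).continuousAt (hO.mem_nhds hzO)
  refine (ContinuousAt.comp (x := y₀) hfd hm).congr ?_
  filter_upwards [hm.preimage_mem_nhds (hO.mem_nhds hzO),
    extChartAt_source_mem_nhds (I := 𝓡 d) y₀] with y hp hp'
  exact (costSecond_eq hO hf hp' hp V).symm

theorem contDiffAt_cost_slice
    (hreg : IsSmoothUpToBoundary ((𝓡 d).prod (𝓡 d)) 4 (fun z : M × N => c z.1 z.2) (A ×ˢ B))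
    {z : M} (hz : z ∈ A) {y : N} (hy : y ∈ B) :
    ContDiffAt ℝ 4 (fun u => c ((extChartAt (𝓡 d) z).symm u) y) (extChartAt (𝓡 d) z z) := by
  obtain ⟨O, hO, hzO, hf⟩ := exists_isOpen_contDiffOn_costInCharts hreg hz hy
  have h := ContDiffAt.comp (extChartAt (𝓡 d) z z) (hf.contDiffAt (hO.mem_nhds hzO))
    (contDiffAt_id.prodMk (contDiffAt_const (c := extChartAt (𝓡 d) y y)))
  refine h.congr_of_eventuallyEq (Eventually.of_forall fun u => ?_)
  simp [costInCharts]

end CostInChart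

/-! ### `c`-segments and strict convexity -/

section CSegments

variable {d : ℕ}
  {M : Type*} [TopologicalSpace M] [ChartedSpace (EuclideanSpace ℝ (Fin d)) M]
  {N : Type*} [TopologicalSpace N] [ChartedSpace (EuclideanSpace ℝ (Fin d)) N]
  {c : M → N → ℝ} {Ω : Set M} {Ω' : Set N}

theorem injOn_costGrad
    (hreg : IsSmoothUpToBoundary ((𝓡 d).prod (𝓡 d)) 4 (fun z : M × N => c z.1 z.2)
      (closure Ω ×ˢ closure Ω'))
    (htwist : TwistOn d c (closure Ω) (closure Ω')) {z : M} (hz : z ∈ closure Ω) :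
    InjOn (costGrad c z (extChartAt (𝓡 d) z z)) (closure Ω') := by
  intro y hy y' hy' h
  refine htwist.1 z hz hy hy' ?_
  have h' : costDFst (d := d) c z y = costDFst (d := d) c z y' :=
    (costDFst_eq_costGrad hreg hz hy).trans (h.trans (costDFst_eq_costGrad hreg hz hy').symm)
  exact congrArg Neg.neg h'

variable [IsManifold (𝓡 d) ∞ M] [IsManifold (𝓡 d) ∞ N]

/-- The convexity of `-Dc(x, Ω')` for `x ∈ Ω` passes to boundary points `z` of `Ω`, with `Ω'`
replaced by its compact closure. -/
theorem exists_costGrad_eq_of_mem_closure [FirstCountableTopology M] [FirstCountableTopology N]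
    (hΩc' : IsCompact (closure Ω'))
    (hreg : IsSmoothUpToBoundary ((𝓡 d).prod (𝓡 d)) 4 (fun z : M × N => c z.1 z.2)
      (closure Ω ×ˢ closure Ω'))
    (hconv' : ∀ x ∈ Ω, CConvexSnd d c Ω' x) {z : M} (hz : z ∈ closure Ω) {y₁ y₂ : N}
    (hy₁ : y₁ ∈ Ω') (hy₂ : y₂ ∈ Ω') {s : ℝ} (hs : s ∈ Icc (0 : ℝ) 1) :
    ∃ y ∈ closure Ω', costGrad c z (extChartAt (𝓡 d) z z) y =
      (1 - s) • costGrad c z (extChartAt (𝓡 d) z z) y₁ +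
        s • costGrad c z (extChartAt (𝓡 d) z z) y₂ := by
  obtain ⟨x, hxΩ, hx⟩ := mem_closure_iff_seq_limit.1 hz
  have hex : ∀ n, ∃ y ∈ Ω', costDFst (d := d) c (x n) y =
      (1 - s) • costDFst (d := d) c (x n) y₁ + s • costDFst (d := d) c (x n) y₂ := by
    intro n
    obtain ⟨y, hy, h⟩ := hconv' (x n) (hxΩ n) (mem_image_of_mem _ hy₁) (mem_image_of_mem _ hy₂)
      (sub_nonneg.2 hs.2) hs.1 (by ring)
    refine ⟨y, hy, ?_⟩
    have h' := congrArg Neg.neg h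
    simpa [neg_add, smul_neg, add_comm] using h'
  choose y hyΩ' hy using hex
  obtain ⟨y', hy', φ, hφ, hlim⟩ := hΩc'.tendsto_subseq fun n => subset_closure (hyΩ' n)
  refine ⟨y', hy', ?_⟩
  have hxφ : Tendsto (x ∘ φ) atTop (𝓝 z) := hx.comp hφ.tendsto_atTop
  have hu : Tendsto (fun n => extChartAt (𝓡 d) z (x (φ n))) atTop (𝓝 (extChartAt (𝓡 d) z z)) :=
    (continuousAt_extChartAt z).tendsto.comp hxφ
  have hP : ∀ {y₀ : N} {v : ℕ → N}, y₀ ∈ closure Ω' → Tendsto v atTop (𝓝 y₀) →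
      Tendsto (fun n => costGrad c z (extChartAt (𝓡 d) z (x (φ n))) (v n)) atTop
        (𝓝 (costGrad c z (extChartAt (𝓡 d) z z) y₀)) := fun hy₀ hv =>
    (continuousAt_costGrad hreg hz hy₀).tendsto.comp (hu.prodMk_nhds hv)
  have h1 := hP hy' hlim
  have h2 := ((hP (subset_closure hy₁) tendsto_const_nhds).const_smul (1 - s)).add
    ((hP (subset_closure hy₂) tendsto_const_nhds).const_smul s)
  refine tendsto_nhds_unique_of_eventuallyEq h1 h2 ?_
  filter_upwards [hxφ.eventually (extChartAt_source_mem_nhds (I := 𝓡 d) z)] with n hn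
  have hxn : x (φ n) ∈ closure Ω := subset_closure (hxΩ _)
  rw [costGrad_eq_costDFst_comp hreg hxn hn (subset_closure hy₁),
    costGrad_eq_costDFst_comp hreg hxn hn (subset_closure hy₂)]
  refine (costGrad_eq_costDFst_comp hreg hxn hn (subset_closure (hyΩ' _))).trans ?_
  rw [hy]
  ext v
  rfl

/-- A right inverse of a continuous injective map on a compact set is continuous along every
continuous curve. -/
theorem continuousOn_of_comp_injOn_isCompact {X Y : Type*} [TopologicalSpace X] [TopologicalSpace Y]
    [T2Space Y] {T : X → Y} {K : Set X} (hK : IsCompact K) (hT : ContinuousOn T K)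
    (hinj : InjOn T K) {J : Set ℝ} {y : ℝ → X} {q : ℝ → Y} (hy : ∀ s ∈ J, y s ∈ K)
    (hq : ContinuousOn q J) (hTy : ∀ s ∈ J, T (y s) = q s) : ContinuousOn y J := by
  have : CompactSpace K := isCompact_iff_compactSpace.1 hK
  have hemb : IsClosedEmbedding (K.domRestrict T) :=
    Continuous.isClosedEmbedding hT.domRestrict (injOn_iff_injective.1 hinj)
  have h1 : Continuous fun s : J => (⟨y s, hy s s.2⟩ : K) := by
    rw [hemb.isInducing.continuous_iff]
    refine (hq.domRestrict).congr fun s => ?_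
    exact (hTy s s.2).symm
  exact continuousOn_iff_continuous_domRestrict.2 (continuous_subtype_val.comp h1)

end CSegments

section StrictConvexity

variable {d : ℕ}
  {M : Type*} [TopologicalSpace M] [ChartedSpace (EuclideanSpace ℝ (Fin d)) M]
  [RiemannianBundle (fun x : M => TangentSpace (𝓡 d) x)]
  {N : Type*} [TopologicalSpace N] [ChartedSpace (EuclideanSpace ℝ (Fin d)) N]
  {c : M → N → ℝ} {Ω : Set M} {Ω' : Set N}

/-- The strong condition at a nonzero pair: the Riemannian norms of `V` and `η` do not vanish. -/
theorem sum_mtwCoord_pos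
    (hmtw : StrongMTWOn d c (closure Ω) (closure Ω')) {z : M} (hz : z ∈ closure Ω) {y : N}
    (hy : y ∈ closure Ω') {V : EuclideanSpace ℝ (Fin d)} (hV : V ≠ 0)
    {η : EuclideanSpace ℝ (Fin d) →L[ℝ] ℝ} (hη : η ≠ 0) (hηV : η V = 0) :
    0 < ∑ i, ∑ j, ∑ k, ∑ l, mtwCoord c z y i j k l * V i * V j *
      η (EuclideanSpace.single k 1) * η (EuclideanSpace.single l 1) := by
  obtain ⟨δ₀, hδ₀, h⟩ := hmtw
  let V' : TangentSpace (𝓡 d) z := V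
  let η' : TangentSpace (𝓡 d) z →L[ℝ] ℝ := η
  have hV0 : V' ≠ 0 := hV
  have hV' : 0 < ‖V'‖ := norm_pos_iff.2 hV0
  have hη' : 0 < ‖η'‖ := by
    obtain ⟨v, hv⟩ : ∃ v, η v ≠ 0 := by
      by_contra! h0
      exact hη (ContinuousLinearMap.ext h0)
    have hle : ‖η' v‖ ≤ ‖η'‖ * ‖(show TangentSpace (𝓡 d) z from v)‖ :=
      ContinuousLinearMap.le_opNorm η' v
    exact pos_of_mul_pos_left ((norm_pos_iff.2 hv).trans_le hle) (norm_nonneg _)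
  refine lt_of_lt_of_le ?_ (h z hz y hy V' η' hηV)
  positivity

/-- If `-Dc(z, y₂)` lies strictly between `-Dc(z, y₁)` and `-Dc(z, y₃)` on a segment, then
`-D²_x c(z, ·)(V, V)` at `y₂` lies strictly below the interpolation of its values at `y₁`
and `y₃`, for every `V ≠ 0` annihilated by the direction of the segment. -/
theorem lt_costSecond_of_between [IsManifold (𝓡 d) ∞ M] [IsManifold (𝓡 d) ∞ N]
    [FirstCountableTopology M] [FirstCountableTopology N]
    (hΩc' : IsCompact (closure Ω'))
    (hreg : IsSmoothUpToBoundary ((𝓡 d).prod (𝓡 d)) 4 (fun z : M × N => c z.1 z.2)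
      (closure Ω ×ˢ closure Ω'))
    (htwist : TwistOn d c (closure Ω) (closure Ω'))
    (hnondeg : NondegOn d c (closure Ω) (closure Ω'))
    (hmtw : StrongMTWOn d c (closure Ω) (closure Ω'))
    (hconv' : ∀ x ∈ Ω, CConvexSnd d c Ω' x) {z : M} (hz : z ∈ closure Ω) {y₁ y₂ y₃ : N}
    (hy₁ : y₁ ∈ Ω') (hy₂ : y₂ ∈ Ω') (hy₃ : y₃ ∈ Ω') (hne : y₁ ≠ y₃) {τ : ℝ} (hτ0 : 0 < τ)
    (hτ1 : τ < 1)
    (hcol : costGrad c z (extChartAt (𝓡 d) z z) y₂ =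
      (1 - τ) • costGrad c z (extChartAt (𝓡 d) z z) y₁ +
        τ • costGrad c z (extChartAt (𝓡 d) z z) y₃)
    {V : EuclideanSpace ℝ (Fin d)} (hV : V ≠ 0)
    (hV0 : costGrad c z (extChartAt (𝓡 d) z z) y₁ V = costGrad c z (extChartAt (𝓡 d) z z) y₃ V) :
    (1 - τ) * costSecond c z V y₁ + τ * costSecond c z V y₃ < costSecond c z V y₂ := by
  set u := extChartAt (𝓡 d) z z with hu
  set P := costGrad c z u with hP
  have hinj : InjOn P (closure Ω') := injOn_costGrad hreg htwist hz
  have hPc : ContinuousOn P (closure Ω') := fun y hy =>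
    (ContinuousAt.comp (x := y) (continuousAt_costGrad hreg hz hy)
      (continuousAt_const.prodMk continuousAt_id)).continuousWithinAt
  have hex : ∀ s : ℝ, ∃ y, s ∈ Icc (0 : ℝ) 1 →
      y ∈ closure Ω' ∧ P y = (1 - s) • P y₁ + s • P y₃ := by
    intro s
    by_cases hs : s ∈ Icc (0 : ℝ) 1
    · obtain ⟨y, hy, h⟩ := exists_costGrad_eq_of_mem_closure hΩc' hreg hconv' hz hy₁ hy₃ hs
      exact ⟨y, fun _ => ⟨hy, h⟩⟩
    · exact ⟨y₁, fun h => absurd h hs⟩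
  choose y hy using hex
  have hyc : ContinuousOn y (Icc 0 1) := by
    refine continuousOn_of_comp_injOn_isCompact hΩc' hPc hinj (fun s hs => (hy s hs).1)
      (q := fun s => (1 - s) • P y₁ + s • P y₃) (by fun_prop) (fun s hs => (hy s hs).2)
  have hη : P y₁ - P y₃ ≠ 0 := fun h =>
    hne (hinj (subset_closure hy₁) (subset_closure hy₃) (sub_eq_zero.1 h))
  have hstrict : StrictConvexOn ℝ (Icc 0 1) fun s => -costSecond c z V (y s) := by
    refine strictConvexOn_of_deriv2_pos (convex_Icc 0 1)
      ((continuousOn_costSecond hreg hz V).comp hyc fun s hs => (hy s hs).1).neg fun s₀ hs₀ => ?_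
    rw [interior_Icc] at hs₀
    have hnhds : Icc (0 : ℝ) 1 ∈ 𝓝 s₀ := Icc_mem_nhds hs₀.1 hs₀.2
    have hys₀ := (hy s₀ ⟨hs₀.1.le, hs₀.2.le⟩).1
    have hyat : ContinuousAt y s₀ := hyc.continuousAt hnhds
    obtain ⟨O, hO, hzO, hf⟩ := exists_isOpen_contDiffOn_costInCharts hreg hz hys₀
    have hwc : ContinuousAt (fun s => extChartAt (𝓡 d) (y s₀) (y s)) s₀ :=
      ContinuousAt.comp (x := s₀) (continuousAt_extChartAt (y s₀)) hyat
    have hev : ∀ᶠ s in 𝓝 s₀, s ∈ Icc (0 : ℝ) 1 ∧ y s ∈ (extChartAt (𝓡 d) (y s₀)).source ∧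
        (u, extChartAt (𝓡 d) (y s₀) (y s)) ∈ O :=
      Filter.Eventually.and hnhds
        ((hyat.eventually (extChartAt_source_mem_nhds (I := 𝓡 d) (y s₀))).and
          ((continuousAt_const.prodMk hwc).preimage_mem_nhds (hO.mem_nhds hzO)))
    have hh : (fun s => -costSecond c z V (y s)) =ᶠ[𝓝 s₀] fun s => -dirDeriv (V, 0)
        (dirDeriv (V, 0) (fun p => costInCharts c z (y s₀) p.1 p.2))
        (u, extChartAt (𝓡 d) (y s₀) (y s)) := by
      filter_upwards [hev] with s hs
      rw [costSecond_eq hO hf hs.2.1 hs.2.2]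
    have hH : IsUnit (mixedHessian d c z (y s₀)) := by
      simpa using (hnondeg z hz (y s₀) hys₀).neg
    have hseg : ∀ᶠ s in 𝓝 s₀, ∀ i, -dirDeriv (dirFst i)
        (fun p => costInCharts c z (y s₀) p.1 p.2) (u, extChartAt (𝓡 d) (y s₀) (y s)) =
          -P y₁ (EuclideanSpace.single i 1) + s * (P y₁ - P y₃) (EuclideanSpace.single i 1) := by
      filter_upwards [hev] with s hs i
      have h1 := costGrad_apply_eq hO hf hs.2.1 hs.2.2 (EuclideanSpace.single i 1)
      have h2 := congrArg (fun L => L (EuclideanSpace.single i 1)) (hy s hs.1).2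
      rw [dirFst, ← h1]
      simp only [hP, add_apply, smul_apply, sub_apply, smul_eq_mul] at h2 ⊢
      rw [h2]
      ring
    rw [Function.iterate_succ, Function.iterate_one, Function.comp_apply, hh.deriv.deriv_eq,
      deriv_deriv_along_cSegment hO hf hzO hH rfl hwc hseg V]
    exact sum_mtwCoord_pos hmtw hz hys₀ hV hη (by simp [hV0])
  have e0 : y 0 = y₁ := by
    have h := hy 0 ⟨le_rfl, zero_le_one⟩
    exact hinj h.1 (subset_closure hy₁) (by rw [h.2]; simp)
  have e1 : y 1 = y₃ := by
    have h := hy 1 ⟨zero_le_one, le_rfl⟩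
    exact hinj h.1 (subset_closure hy₃) (by rw [h.2]; simp)
  have eτ : y τ = y₂ := by
    have h := hy τ ⟨hτ0.le, hτ1.le⟩
    exact hinj h.1 (subset_closure hy₂) (by rw [h.2, hcol])
  have := hstrict.2 (x := 0) ⟨le_rfl, zero_le_one⟩ (y := 1) ⟨zero_le_one, le_rfl⟩
    zero_ne_one (sub_pos.2 hτ1) hτ0 (by ring)
  simp only [smul_eq_mul, mul_zero, mul_one, zero_add, e0, e1, eτ] at this
  linarith

end StrictConvexity

/-! ### Three target points, and the local volume estimate -/

section Intersections

open scoped NNReal ENNReal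

variable {d : ℕ}
  {M : Type*} [TopologicalSpace M] [ChartedSpace (EuclideanSpace ℝ (Fin d)) M]
  [IsManifold (𝓡 d) ∞ M]
  {N : Type*} [TopologicalSpace N] [ChartedSpace (EuclideanSpace ℝ (Fin d)) N]
  [IsManifold (𝓡 d) ∞ N]
  {c : M → N → ℝ} {Ω : Set M} {Ω' : Set N}

theorem fderiv_cost_sub_apply {A : Set M} {B : Set N}
    (hreg : IsSmoothUpToBoundary ((𝓡 d).prod (𝓡 d)) 4 (fun z : M × N => c z.1 z.2) (A ×ˢ B))
    {z : M} (hz : z ∈ A) {y₁ y₂ : N} (hy₁ : y₁ ∈ B) (hy₂ : y₂ ∈ B) (b : ℝ) :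
    ∀ᶠ u in 𝓝 (extChartAt (𝓡 d) z z),
      fderiv ℝ (fun u => c ((extChartAt (𝓡 d) z).symm u) y₁ -
        c ((extChartAt (𝓡 d) z).symm u) y₂ - b) u = costGrad c z u y₁ - costGrad c z u y₂ := by
  have h1 := (contDiffAt_cost_slice hreg hz hy₁).eventually (by simp)
  have h2 := (contDiffAt_cost_slice hreg hz hy₂).eventually (by simp)
  filter_upwards [h1, h2] with u hu1 hu2
  rw [fderiv_sub_const, fderiv_fun_sub (hu1.differentiableAt (by norm_num))
    (hu2.differentiableAt (by norm_num))]
  rfl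

theorem fderiv_fderiv_cost_sub_apply {A : Set M} {B : Set N}
    (hreg : IsSmoothUpToBoundary ((𝓡 d).prod (𝓡 d)) 4 (fun z : M × N => c z.1 z.2) (A ×ˢ B))
    {z : M} (hz : z ∈ A) {y₁ y₂ : N} (hy₁ : y₁ ∈ B) (hy₂ : y₂ ∈ B) (b : ℝ)
    (V : EuclideanSpace ℝ (Fin d)) :
    fderiv ℝ (fun u => fderiv ℝ (fun u => c ((extChartAt (𝓡 d) z).symm u) y₁ -
        c ((extChartAt (𝓡 d) z).symm u) y₂ - b) u V) (extChartAt (𝓡 d) z z) V =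
      costSecond c z V y₁ - costSecond c z V y₂ := by
  have hev : (fun u => fderiv ℝ (fun u => c ((extChartAt (𝓡 d) z).symm u) y₁ -
        c ((extChartAt (𝓡 d) z).symm u) y₂ - b) u V) =ᶠ[𝓝 (extChartAt (𝓡 d) z z)]
      fun u => costGrad c z u y₁ V - costGrad c z u y₂ V := by
    filter_upwards [fderiv_cost_sub_apply hreg hz hy₁ hy₂ b] with u hu
    rw [hu]
    rfl
  have hd : ∀ y ∈ B, DifferentiableAt ℝ (fun u => costGrad c z u y V) (extChartAt (𝓡 d) z z) :=
    fun y hy => (((contDiffAt_cost_slice hreg hz hy).fderiv_right (m := 3)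
      (by norm_num)).clm_apply contDiffAt_const).differentiableAt (by norm_num)
  rw [hev.fderiv_eq, fderiv_fun_sub (hd y₁ hy₁) (hd y₂ hy₂)]
  rfl

variable [RiemannianBundle (fun x : M => TangentSpace (𝓡 d) x)]

/-- For three distinct target points, the differences of the gradients of the cost and the
differences of its second derivatives are never proportional with the same factor. -/
theorem costSecond_sub_ne_mul_sub [FirstCountableTopology M] [FirstCountableTopology N]
    (hΩc' : IsCompact (closure Ω'))
    (hreg : IsSmoothUpToBoundary ((𝓡 d).prod (𝓡 d)) 4 (fun z : M × N => c z.1 z.2)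
      (closure Ω ×ˢ closure Ω'))
    (htwist : TwistOn d c (closure Ω) (closure Ω'))
    (hnondeg : NondegOn d c (closure Ω) (closure Ω'))
    (hmtw : StrongMTWOn d c (closure Ω) (closure Ω'))
    (hconv' : ∀ x ∈ Ω, CConvexSnd d c Ω' x) {z : M} (hz : z ∈ closure Ω) {y₁ y₂ y₃ : N}
    (hy₁ : y₁ ∈ Ω') (hy₂ : y₂ ∈ Ω') (hy₃ : y₃ ∈ Ω') (h12 : y₁ ≠ y₂) (h13 : y₁ ≠ y₃)
    (h23 : y₂ ≠ y₃) {a : ℝ}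
    (hcol : costGrad c z (extChartAt (𝓡 d) z z) y₁ - costGrad c z (extChartAt (𝓡 d) z z) y₃ =
      a • (costGrad c z (extChartAt (𝓡 d) z z) y₁ - costGrad c z (extChartAt (𝓡 d) z z) y₂))
    {V : EuclideanSpace ℝ (Fin d)} (hV : V ≠ 0)
    (hV0 : costGrad c z (extChartAt (𝓡 d) z z) y₁ V = costGrad c z (extChartAt (𝓡 d) z z) y₂ V) :
    costSecond c z V y₁ - costSecond c z V y₃ ≠
      a * (costSecond c z V y₁ - costSecond c z V y₂) := by
  intro hQ
  set P := costGrad c z (extChartAt (𝓡 d) z z) with hP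
  have hinj : InjOn P (closure Ω') := injOn_costGrad hreg htwist hz
  have hlt := fun {y₁ y₂ y₃ : N} (hy₁ : y₁ ∈ Ω') (hy₂ : y₂ ∈ Ω') (hy₃ : y₃ ∈ Ω') (hne : y₁ ≠ y₃)
    {τ : ℝ} (hτ0 : 0 < τ) (hτ1 : τ < 1) (hc : P y₂ = (1 - τ) • P y₁ + τ • P y₃)
    (h0 : P y₁ V = P y₃ V) => lt_costSecond_of_between hΩc' hreg htwist hnondeg hmtw hconv' hz
      hy₁ hy₂ hy₃ hne hτ0 hτ1 hc hV h0
  have hP3 : P y₃ = P y₁ - a • (P y₁ - P y₂) := by rw [← hcol]; abel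
  have hV3 : P y₁ V = P y₃ V := by rw [hP3]; simp [hV0]
  -- The factor is neither `0` nor `1`, since the gradients at distinct targets are distinct.
  have ha0 : a ≠ 0 := by
    rintro rfl
    exact h13 (hinj (subset_closure hy₁) (subset_closure hy₃) (by rw [hP3]; simp))
  have ha1 : a ≠ 1 := by
    rintro rfl
    exact h23 (hinj (subset_closure hy₂) (subset_closure hy₃) (by rw [hP3]; simp))
  rcases lt_or_gt_of_ne ha0 with ha | ha
  · -- `y₁` is between `y₃` and `y₂`.
    have h1a : 0 < 1 - a := by linarith
    have := hlt hy₃ hy₁ hy₂ h23.symm (τ := -a / (1 - a)) (div_pos (by linarith) h1a)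
      (by rw [div_lt_one h1a]; linarith)
      (by
        rw [hP3, show 1 - -a / (1 - a) = 1 / (1 - a) by field_simp; ring]
        match_scalars <;> field_simp
        ring) (hV3 ▸ hV0)
    rw [show 1 - -a / (1 - a) = 1 / (1 - a) by field_simp; ring, ← sub_pos] at this
    have h2 := mul_pos h1a this
    field_simp at h2
    nlinarith
  rcases lt_or_gt_of_ne ha1 with ha' | ha'
  · -- `y₃` is between `y₁` and `y₂`.
    have := hlt hy₁ hy₃ hy₂ h12 ha ha' (by rw [hP3]; module) hV0
    nlinarith
  · -- `y₂` is between `y₁` and `y₃`.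
    have := hlt hy₁ hy₂ hy₃ h13 (τ := 1 / a) (by positivity) (by rw [div_lt_one ha]; exact ha')
      (by
        rw [hP3]
        match_scalars <;> field_simp
        ring) hV3
    rw [← sub_pos] at this
    have h2 := mul_pos ha this
    field_simp at h2
    nlinarith

variable [SecondCountableTopology M] [SecondCountableTopology N]
  [IsContMDiffRiemannianBundle (𝓡 d) ∞ (EuclideanSpace ℝ (Fin d))
    (fun x : M => TangentSpace (𝓡 d) x)]
  [MeasurableSpace M] [BorelSpace M]

/-- The local form of the estimate, at interior and boundary points of `Ω` alike. -/
theorem exists_nhds_riemannianVolume_isLittleO (hd : 2 ≤ d)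
    (hΩc' : IsCompact (closure Ω'))
    (hreg : IsSmoothUpToBoundary ((𝓡 d).prod (𝓡 d)) 4 (fun z : M × N => c z.1 z.2)
      (closure Ω ×ˢ closure Ω'))
    (htwist : TwistOn d c (closure Ω) (closure Ω'))
    (hnondeg : NondegOn d c (closure Ω) (closure Ω'))
    (hmtw : StrongMTWOn d c (closure Ω) (closure Ω'))
    (hconv' : ∀ x ∈ Ω, CConvexSnd d c Ω' x) {z : M} (hz : z ∈ closure Ω) {y₁ y₂ y₃ : N}
    (hy₁ : y₁ ∈ Ω') (hy₂ : y₂ ∈ Ω') (hy₃ : y₃ ∈ Ω') (h12 : y₁ ≠ y₂) (h13 : y₁ ≠ y₃)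
    (h23 : y₂ ≠ y₃) (b₂ b₃ : ℝ) :
    ∃ U ∈ 𝓝 z, ∀ ε : ℝ, 0 < ε → ∀ᶠ t in 𝓝[≥] (0 : ℝ),
      riemannianVolume d M {x ∈ U | |c x y₁ - c x y₂ - b₂| ≤ t ∧ |c x y₁ - c x y₃ - b₃| ≤ t} ≤
        ENNReal.ofReal (ε * t) := by
  have hB : ∀ {y}, y ∈ Ω' → y ∈ closure Ω' := fun h => subset_closure h
  have hsm : ∀ {y y' : N} (b : ℝ), y ∈ Ω' → y' ∈ Ω' → ContDiffAt ℝ 2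
      (fun u => c ((extChartAt (𝓡 d) z).symm u) y - c ((extChartAt (𝓡 d) z).symm u) y' - b)
      (extChartAt (𝓡 d) z z) := fun b h h' =>
    ((((contDiffAt_cost_slice hreg hz (hB h)).sub (contDiffAt_cost_slice hreg hz (hB h'))).sub
      contDiffAt_const).of_le (by norm_num))
  have hinj := injOn_costGrad hreg htwist hz
  have hgrad : ∀ {y y' : N} (b : ℝ), y ∈ Ω' → y' ∈ Ω' →
      fderiv ℝ (fun u => c ((extChartAt (𝓡 d) z).symm u) y -
        c ((extChartAt (𝓡 d) z).symm u) y' - b) (extChartAt (𝓡 d) z z) =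
      costGrad c z (extChartAt (𝓡 d) z z) y - costGrad c z (extChartAt (𝓡 d) z z) y' :=
    fun b h h' => (fderiv_cost_sub_apply hreg hz (hB h) (hB h') b).self_of_nhds
  obtain ⟨UE, hUE, hsmall⟩ := exists_nhds_measure_abs_le_abs_le_isLittleO volume
    (hsm b₂ hy₁ hy₂) (hsm b₃ hy₁ hy₃)
    (by
      rw [hgrad b₂ hy₁ hy₂]
      exact fun h => h12 (hinj (hB hy₁) (hB hy₂) (sub_eq_zero.1 h)))
    (by
      intro a ha
      rw [hgrad b₂ hy₁ hy₂, hgrad b₃ hy₁ hy₃] at ha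
      -- In dimension at least two there is a tangent vector annihilated by the first gradient.
      obtain ⟨V, hVker, hV⟩ := Submodule.exists_mem_ne_zero_of_ne_bot
        (LinearMap.ker_ne_bot_of_finrank_lt
          (f := (costGrad c z (extChartAt (𝓡 d) z z) y₁ -
            costGrad c z (extChartAt (𝓡 d) z z) y₂).toLinearMap) (by simp; omega))
      have hV0 : costGrad c z (extChartAt (𝓡 d) z z) y₁ V =
          costGrad c z (extChartAt (𝓡 d) z z) y₂ V := sub_eq_zero.1 hVker
      refine ⟨V, ?_, ?_⟩
      · rw [hgrad b₂ hy₁ hy₂]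
        exact hVker
      · rw [fderiv_fderiv_cost_sub_apply hreg hz (hB hy₁) (hB hy₂),
          fderiv_fderiv_cost_sub_apply hreg hz (hB hy₁) (hB hy₃)]
        exact costSecond_sub_ne_mul_sub hΩc' hreg htwist hnondeg hmtw hconv' hz hy₁ hy₂ hy₃
          h12 h13 h23 ha hV hV0)
  obtain ⟨W, hW, C, hvol⟩ := exists_riemannianVolume_le (d := d) z
  obtain ⟨U₀, hU₀, hAU₀, hc⟩ := hreg
  have hcn : ∀ y, ContinuousOn (fun x => c x y) {x | (x, y) ∈ U₀} := fun y =>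
    ContinuousOn.comp (f := fun x : M => (x, y)) (t := U₀) hc.continuousOn
      (by fun_prop : Continuous fun x : M => (x, y)).continuousOn fun x hx => hx
  have hcU : ∀ y ∈ Ω', {x : M | (x, y) ∈ U₀} ∈ 𝓝 z := fun y hy =>
    (hU₀.preimage (by fun_prop : Continuous fun x : M => (x, y))).mem_nhds (hAU₀ ⟨hz, hB hy⟩)
  have hn : (extChartAt (𝓡 d) z).source ∩ (extChartAt (𝓡 d) z ⁻¹' (W ∩ UE)) ∩
      ({x | (x, y₁) ∈ U₀} ∩ {x | (x, y₂) ∈ U₀} ∩ {x | (x, y₃) ∈ U₀}) ∈ 𝓝 z :=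
    inter_mem (inter_mem (extChartAt_source_mem_nhds z)
      ((continuousAt_extChartAt z).preimage_mem_nhds (inter_mem hW hUE)))
      (inter_mem (inter_mem (hcU _ hy₁) (hcU _ hy₂)) (hcU _ hy₃))
  obtain ⟨U, hUs, hUo, hzU⟩ := mem_nhds_iff.1 hn
  refine ⟨U, hUo.mem_nhds hzU, fun ε hε => ?_⟩
  have hε' : 0 < ε / (C + 1) := by positivity
  filter_upwards [hsmall _ hε', self_mem_nhdsWithin] with t ht ht0
  have ht0 : 0 ≤ t := ht0
  have hcont : ∀ {y} (b : ℝ), ContinuousOn (fun x => c x y) U →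
      ContinuousOn (fun x => |c x y₁ - c x y - b|) U := fun b h =>
    ((((hcn y₁).mono fun x hx => (hUs hx).2.1.1).sub h).sub continuousOn_const).abs
  have hm : MeasurableSet
      {x ∈ U | |c x y₁ - c x y₂ - b₂| ≤ t ∧ |c x y₁ - c x y₃ - b₃| ≤ t} := by
    have h1 := (hcont b₂ ((hcn y₂).mono fun x hx => (hUs hx).2.1.2)).measurableSet_inter_preimage
      hUo.measurableSet (measurableSet_Iic (a := t))
    have h2 := (hcont b₃ ((hcn y₃).mono fun x hx => (hUs hx).2.2)).measurableSet_inter_preimage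
      hUo.measurableSet (measurableSet_Iic (a := t))
    convert h1.inter h2 using 1
    ext x
    simp only [mem_ofPred_eq, mem_inter_iff, mem_preimage, mem_Iic]
    tauto
  refine (hvol _ hm (fun x hx => (hUs hx.1).1.1) (fun x hx => (hUs hx.1).1.2.1)).trans ?_
  calc _ ≤ C * ENNReal.ofReal (ε / (C + 1) * t) := by
        gcongr
        refine le_trans (measure_mono ?_) ht
        rintro u ⟨⟨hu, hu'⟩, hut⟩
        refine ⟨?_, hu'⟩
        have := (hUs hu).1.2.2
        rwa [(extChartAt (𝓡 d) z).right_inv hut] at this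
    _ ≤ ENNReal.ofReal (ε * t) := by
        rw [← ENNReal.ofReal_coe_nnreal, ← ENNReal.ofReal_mul C.coe_nonneg]
        refine ENNReal.ofReal_le_ofReal ?_
        rw [← mul_assoc, ← mul_div_assoc]
        refine mul_le_mul_of_nonneg_right ?_ ht0
        rw [div_le_iff₀ (by positivity)]
        nlinarith [C.coe_nonneg]

end Intersections

/-! ### From levels to weights -/

section Weights

variable {K : ℕ}

/-- The logarithm is Lipschitz near the positive number `w l`. -/
theorem exists_eventually_abs_log_add_sub_le {w : Fin K → ℝ} (hw : ∀ l, 0 < w l) (l : Fin K) :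
    ∃ L : ℝ, ∀ᶠ Δ : Fin K → ℝ in 𝓝 0, |Real.log (w l + Δ l) - Real.log (w l)| ≤ L * ‖Δ‖ := by
  have h1 := (Real.hasDerivAt_log (hw l).ne').isBigO_sub
  have h2 : Tendsto (fun Δ : Fin K → ℝ => w l + Δ l) (𝓝 0) (𝓝 (w l)) := by
    have : Continuous fun Δ : Fin K → ℝ => w l + Δ l := by fun_prop
    simpa using this.tendsto 0
  obtain ⟨L, hL⟩ := (h1.comp_tendsto h2).bound
  refine ⟨|L|, hL.mono fun Δ h => ?_⟩
  simp only [Function.comp_apply, add_sub_cancel_left, Real.norm_eq_abs] at h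
  refine h.trans (mul_le_mul (le_abs_self L) ?_ (abs_nonneg _) (abs_nonneg _))
  exact norm_le_pi_norm Δ l

variable {M N : Type*} {c : M → N → ℝ} {Ω : Set M} {y : Fin K → N} {w Δ : Fin K → ℝ} {i j : Fin K}

theorem abs_le_of_mem_wSetDelta_diff {x : M} (hx : x ∈ wSetDelta c Ω y w Δ i j \ wSet c Ω y w i j) :
    x ∈ Ω ∧ |c x (y i) - c x (y j) - (Real.log (w j) - Real.log (w i))| ≤
      |Real.log (w j + Δ j) - Real.log (w j)| := by
  obtain ⟨⟨hΩ, h1⟩, h2⟩ := hx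
  have h3 : ¬(-c x (y j) - Real.log (w j) ≤ -c x (y i) - Real.log (w i)) := fun h => h2 ⟨hΩ, h⟩
  refine ⟨hΩ, abs_le_abs ?_ ?_⟩ <;> linarith

theorem abs_le_of_mem_wSet_diff {x : M} (hx : x ∈ wSet c Ω y w i j \ wSetDelta c Ω y w Δ i j) :
    x ∈ Ω ∧ |c x (y i) - c x (y j) - (Real.log (w j) - Real.log (w i))| ≤
      |Real.log (w j + Δ j) - Real.log (w j)| := by
  obtain ⟨⟨hΩ, h1⟩, h2⟩ := hx
  have h3 : ¬(-c x (y j) - Real.log (w j + Δ j) ≤ -c x (y i) - Real.log (w i)) :=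
    fun h => h2 ⟨hΩ, h⟩
  rw [← abs_neg (c x (y i) - _ - _), ← abs_neg (Real.log (w j + Δ j) - _)]
  refine ⟨hΩ, abs_le_abs ?_ ?_⟩ <;> linarith

theorem wSetDelta_self (h : Δ i = 0) : wSetDelta c Ω y w Δ i i = wSet c Ω y w i i := by
  rw [wSetDelta, wSet, h, add_zero]

end Weights

section Assembly

open scoped NNReal ENNReal

theorem withDensity_ofReal_apply_le {M : Type*} [MeasurableSpace M] {ν : Measure M} {Ω : Set M}
    (hΩ : MeasurableSet Ω) {I : M → ℝ} {C : ℝ} (hC : ∀ x ∈ Ω, I x ≤ C) (S : Set M) :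
    (ν.restrict Ω).withDensity (fun x => ENNReal.ofReal (I x)) S ≤
      ENNReal.ofReal C * ν (S ∩ Ω) := by
  have h1 : (ν.restrict Ω).withDensity (fun x => ENNReal.ofReal (I x)) ≤
      (ν.restrict Ω).withDensity (fun _ => ENNReal.ofReal C) :=
    withDensity_mono ((ae_restrict_iff' hΩ).2 (Eventually.of_forall fun x hx =>
      ENNReal.ofReal_le_ofReal (hC x hx)))
  refine (h1 S).trans_eq ?_
  rw [withDensity_const, Measure.smul_apply, Measure.restrict_apply' hΩ, smul_eq_mul]

/-- An `o(t)` bound for the sets `|f| ≤ t`, `|g| ≤ t` near each point of a compact set holds on the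
whole set. -/
theorem eventually_measure_le_of_isCompact {M : Type*} [TopologicalSpace M] [MeasurableSpace M]
    {ν : Measure M} {f g : M → ℝ} {S : Set M} (hS : IsCompact S)
    (h : ∀ z ∈ S, ∃ U ∈ 𝓝 z, ∀ ε : ℝ, 0 < ε → ∀ᶠ t in 𝓝[≥] (0 : ℝ),
      ν {x ∈ U | |f x| ≤ t ∧ |g x| ≤ t} ≤ ENNReal.ofReal (ε * t)) :
    ∀ ε : ℝ, 0 < ε → ∀ᶠ t in 𝓝[≥] (0 : ℝ),
      ν {x ∈ S | |f x| ≤ t ∧ |g x| ≤ t} ≤ ENNReal.ofReal (ε * t) := by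
  refine hS.induction_on (p := fun S => ∀ ε : ℝ, 0 < ε → ∀ᶠ t in 𝓝[≥] (0 : ℝ),
    ν {x ∈ S | |f x| ≤ t ∧ |g x| ≤ t} ≤ ENNReal.ofReal (ε * t)) ?_ ?_ ?_ ?_
  · intro ε _
    simp
  · intro S T hST hT ε hε
    filter_upwards [hT ε hε] with t ht
    refine le_trans (measure_mono ?_) ht
    exact fun x hx => ⟨hST hx.1, hx.2⟩
  · intro S T hS hT ε hε
    filter_upwards [hS _ (half_pos hε), hT _ (half_pos hε), self_mem_nhdsWithin] with t h1 h2 ht0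
    have ht0 : 0 ≤ t := ht0
    calc ν {x ∈ S ∪ T | |f x| ≤ t ∧ |g x| ≤ t}
        ≤ ν ({x ∈ S | |f x| ≤ t ∧ |g x| ≤ t} ∪ {x ∈ T | |f x| ≤ t ∧ |g x| ≤ t}) := by
          refine measure_mono ?_
          rintro x ⟨hx | hx, h⟩
          · exact Or.inl ⟨hx, h⟩
          · exact Or.inr ⟨hx, h⟩
      _ ≤ _ := measure_union_le _ _
      _ ≤ _ := add_le_add h1 h2
      _ = _ := by
          rw [← ENNReal.ofReal_add (by positivity) (by positivity)]
          congr 1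
          ring
  · intro z hz
    obtain ⟨U, hU, h⟩ := h z hz
    exact ⟨U, mem_nhdsWithin_of_mem_nhds hU, h⟩

/-- The logarithms of the weights are Lipschitz near `w`, so an `o(t)` bound in the size `t` of the
values of `G₁` and `G₂` is an `o(|Δ|)` bound in the increment of the weights. -/
theorem isLittleO_measureReal_of_subset {M : Type*} [MeasurableSpace M] {μ : Measure M}
    {G₁ G₂ : M → ℝ} {Ω : Set M} {K : ℕ} {w : Fin K → ℝ} (hw : ∀ l, 0 < w l) {j k : Fin K}
    (hsmall : ∀ ε : ℝ, 0 < ε → ∀ᶠ t in 𝓝[≥] (0 : ℝ),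
      μ {x ∈ Ω | |G₁ x| ≤ t ∧ |G₂ x| ≤ t} ≤ ENNReal.ofReal (ε * t))
    {l : Filter (Fin K → ℝ)} (hl : l ≤ 𝓝 0) {S : (Fin K → ℝ) → Set M}
    (hS : ∀ Δ, ∀ x ∈ S Δ, x ∈ Ω ∧ |G₁ x| ≤ |Real.log (w j + Δ j) - Real.log (w j)| ∧
      |G₂ x| ≤ |Real.log (w k + Δ k) - Real.log (w k)|) :
    (fun Δ => μ.real (S Δ)) =o[l] fun Δ => ‖Δ‖ := by
  obtain ⟨L₁, h₁⟩ := exists_eventually_abs_log_add_sub_le hw j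
  obtain ⟨L₂, h₂⟩ := exists_eventually_abs_log_add_sub_le hw k
  set L := max (max L₁ L₂) 1 with hL
  have hL0 : 0 < L := lt_of_lt_of_le one_pos (le_max_right _ _)
  have ht : Tendsto (fun Δ : Fin K → ℝ => L * ‖Δ‖) (𝓝 0) (𝓝[≥] 0) := by
    refine tendsto_nhdsWithin_iff.2 ⟨?_, Eventually.of_forall fun Δ => by
      simp only [mem_Ici]; positivity⟩
    have : Continuous fun Δ : Fin K → ℝ => L * ‖Δ‖ := by fun_prop
    simpa using this.tendsto 0
  refine IsLittleO.mono ?_ hl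
  refine isLittleO_iff.2 fun ε hε => ?_
  filter_upwards [h₁, h₂, ht.eventually (hsmall (ε / L) (by positivity))] with Δ hΔ1 hΔ2 hΔ
  have hle : μ (S Δ) ≤ ENNReal.ofReal (ε * ‖Δ‖) := by
    refine (measure_mono fun x hx => ?_).trans (hΔ.trans_eq ?_)
    · obtain ⟨hxΩ, hx1, hx2⟩ := hS Δ x hx
      refine ⟨hxΩ, hx1.trans (hΔ1.trans ?_), hx2.trans (hΔ2.trans ?_)⟩
      · gcongr
        exact (le_max_left _ _).trans (le_max_left _ _)
      · gcongr
        exact (le_max_right _ _).trans (le_max_left _ _)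
    · congr 1
      field_simp
  rw [Real.norm_of_nonneg measureReal_nonneg, norm_norm]
  exact ENNReal.toReal_le_of_le_ofReal (by positivity) hle

end Assembly

theorem mainTheorem4 {d : ℕ} (hd : 2 ≤ d)
    -- the `d`-dimensional Riemannian manifolds `M` and `N`
    {M : Type*} [TopologicalSpace M] [T2Space M] [SecondCountableTopology M]
    [ChartedSpace (EuclideanSpace ℝ (Fin d)) M] [IsManifold (𝓡 d) ∞ M]
    [RiemannianBundle (fun x : M => TangentSpace (𝓡 d) x)]
    [IsContMDiffRiemannianBundle (𝓡 d) ∞ (EuclideanSpace ℝ (Fin d))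
      (fun x : M => TangentSpace (𝓡 d) x)]
    [MeasurableSpace M] [BorelSpace M]
    {N : Type*} [TopologicalSpace N] [T2Space N] [SecondCountableTopology N]
    [ChartedSpace (EuclideanSpace ℝ (Fin d)) N] [IsManifold (𝓡 d) ∞ N]
    [RiemannianBundle (fun y : N => TangentSpace (𝓡 d) y)]
    [IsContMDiffRiemannianBundle (𝓡 d) ∞ (EuclideanSpace ℝ (Fin d))
      (fun y : N => TangentSpace (𝓡 d) y)]
    -- the domains
    (Ω : Set M) (hΩ : IsOpen Ω) (hΩc : IsCompact (closure Ω))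
    (Ω' : Set N) (hΩ' : IsOpen Ω') (hΩc' : IsCompact (closure Ω'))
    -- the measure `μ = I dVol`
    (I : M → ℝ) (hI : IsSmoothUpToBoundary (𝓡 d) ∞ I (closure Ω)) (hI0 : ∀ x ∈ Ω, 0 ≤ I x)
    (hI1 : ∫ x in Ω, I x ∂(riemannianVolume d M) = 1)
    (μ : Measure M)
    (hμ : μ = ((riemannianVolume d M).restrict Ω).withDensity (fun x => ENNReal.ofReal (I x)))
    -- the cost function
    (c : M → N → ℝ)
    (hreg : IsSmoothUpToBoundary ((𝓡 d).prod (𝓡 d)) 4 (fun z : M × N => c z.1 z.2)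
      (closure Ω ×ˢ closure Ω'))
    (htwist : TwistOn d c (closure Ω) (closure Ω'))
    (hnondeg : NondegOn d c (closure Ω) (closure Ω'))
    (hmtw : StrongMTWOn d c (closure Ω) (closure Ω'))
    -- the target points
    {K : ℕ} (y : Fin K → N) (hy : Function.Injective y) (hyΩ' : ∀ l, y l ∈ Ω')
    -- `c`-convexity of the domains
    (hconv : ∀ l, CConvexFst d c Ω (y l))
    (hconv' : ∀ x ∈ Ω, CConvexSnd d c Ω' x)
    -- the weights and the indices
    (w : Fin K → ℝ) (hw : ∀ l, 0 < w l) (i j k : Fin K) (hjk : j ≠ k) :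
    ((fun Δ : Fin K → ℝ =>
        μ.real ((wSetDelta c Ω y w Δ i j \ wSet c Ω y w i j) ∩
          (wSetDelta c Ω y w Δ i k \ wSet c Ω y w i k)))
      =o[𝓝[{Δ : Fin K → ℝ | Δ i = 0 ∧ ∀ l, 0 < w l + Δ l}] 0] fun Δ => ‖Δ‖) ∧
    ((fun Δ : Fin K → ℝ =>
        μ.real ((wSet c Ω y w i j \ wSetDelta c Ω y w Δ i j) ∩
          (wSet c Ω y w i k \ wSetDelta c Ω y w Δ i k)))
      =o[𝓝[{Δ : Fin K → ℝ | Δ i = 0 ∧ ∀ l, 0 < w l + Δ l}] 0] fun Δ => ‖Δ‖) := by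
  by_cases hji : j = i
  · -- For `j = i` the increment of the weight vanishes and the differences are empty.
    have h : ∀ᶠ Δ in 𝓝[{Δ : Fin K → ℝ | Δ i = 0 ∧ ∀ l, 0 < w l + Δ l}] 0,
        wSetDelta c Ω y w Δ i j = wSet c Ω y w i j := by
      filter_upwards [self_mem_nhdsWithin] with Δ hΔ
      rw [hji, wSetDelta_self hΔ.1]
    constructor <;> refine (isLittleO_zero _ _).congr' ?_ EventuallyEq.rfl <;>
      filter_upwards [h] with Δ hΔ <;> simp [hΔ]
  by_cases hki : k = i
  · have h : ∀ᶠ Δ in 𝓝[{Δ : Fin K → ℝ | Δ i = 0 ∧ ∀ l, 0 < w l + Δ l}] 0,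
        wSetDelta c Ω y w Δ i k = wSet c Ω y w i k := by
      filter_upwards [self_mem_nhdsWithin] with Δ hΔ
      rw [hki, wSetDelta_self hΔ.1]
    constructor <;> refine (isLittleO_zero _ _).congr' ?_ EventuallyEq.rfl <;>
      filter_upwards [h] with Δ hΔ <;> simp [hΔ]
  obtain ⟨C, hC⟩ : ∃ C : ℝ, ∀ x ∈ closure Ω, I x ≤ C := by
    obtain ⟨U, hU, hΩU, hIU⟩ := hI
    obtain ⟨C, hC⟩ := (hΩc.image_of_continuousOn (hIU.continuousOn.mono hΩU)).bddAbove
    exact ⟨C, fun x hx => hC (mem_image_of_mem I hx)⟩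
  have hvol := eventually_measure_le_of_isCompact (ν := riemannianVolume d M) hΩc fun z hz =>
    exists_nhds_riemannianVolume_isLittleO hd hΩc' hreg htwist hnondeg hmtw hconv' hz
      (hyΩ' i) (hyΩ' j) (hyΩ' k) (hy.ne (Ne.symm hji)) (hy.ne (Ne.symm hki)) (hy.ne hjk)
      (Real.log (w j) - Real.log (w i)) (Real.log (w k) - Real.log (w i))
  have hsmall : ∀ ε : ℝ, 0 < ε → ∀ᶠ t in 𝓝[≥] (0 : ℝ),
      μ {x ∈ Ω | |c x (y i) - c x (y j) - (Real.log (w j) - Real.log (w i))| ≤ t ∧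
        |c x (y i) - c x (y k) - (Real.log (w k) - Real.log (w i))| ≤ t} ≤
      ENNReal.ofReal (ε * t) := by
    intro ε hε
    filter_upwards [hvol (ε / (|C| + 1)) (by positivity), self_mem_nhdsWithin] with t ht ht0
    have ht0 : 0 ≤ t := ht0
    rw [hμ]
    calc _ ≤ _ := withDensity_ofReal_apply_le hΩ.measurableSet
          (fun x hx => (hC x (subset_closure hx)).trans (le_abs_self C)) _
      _ ≤ ENNReal.ofReal |C| * ENNReal.ofReal (ε / (|C| + 1) * t) := by
          refine mul_le_mul_right (le_trans (measure_mono ?_) ht) _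
          exact fun x hx => ⟨subset_closure hx.2, hx.1.2⟩
      _ ≤ _ := by
          rw [← ENNReal.ofReal_mul (abs_nonneg C)]
          refine ENNReal.ofReal_le_ofReal ?_
          rw [← mul_assoc, ← mul_div_assoc]
          refine mul_le_mul_of_nonneg_right ?_ ht0
          rw [div_le_iff₀ (by positivity)]
          nlinarith [abs_nonneg C]
  constructor <;> refine isLittleO_measureReal_of_subset (j := j) (k := k) hw hsmall
    nhdsWithin_le_nhds fun Δ x hx => ?_
  · have h1 := abs_le_of_mem_wSetDelta_diff hx.1
    exact ⟨h1.1, h1.2, (abs_le_of_mem_wSetDelta_diff hx.2).2⟩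
  · have h1 := abs_le_of_mem_wSet_diff hx.1
    exact ⟨h1.1, h1.2, (abs_le_of_mem_wSet_diff hx.2).2⟩
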